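/- Let $G$ be a group with a finite generating set $X$. For an integer $n\ge 1$ write $s_n(G,X)$ for the number of elements of $G$ that can be expressed as a product of at most $n$ elements of $X\cup X^{-1}$. Say that a finitely generated group $G$ has polynomial growth of degree $d$ if, for a finite generating set $S$ of $G$, there exist real numbers $a$ and $C$ such that $s_n(G,S)\le Cn^a$ for all $n\ge 1$, and $d$ is the infimum of those $a$ for which such a $C$ exists (this does not depend on the choice of $S$). For a finitely generated nilpotent group $H$ of class $c$ with lower central series $H=\gamma_1(H)\ge\gamma_2(H)\ge\cdots\ge\gamma_{c+1}(H)=\{1\}$, the Hirsch length of $H$ is $h(H):=\sum_{i=1}^c r(i)$, where $r(i)$ is the torsion-free rank of the abelian group $\gamma_i(H)/\gamma_{i+1}(H)$. For a finitely generated group $G$ that has a nilpotent subgroup of finite index (a virtually nilpotent group), the Hirsch length $h(G)$ is $h(H)$ for any nilpotent subgroup $H\le G$ of finite index. For an integer $k\ge 0$ let $g(k)$ be the maximum order of a finite subgroup of $\mathrm{GL}_k(\mathbb{Z})$. **Theorem.** Let $d\ge 1$ be an integer, let $G$ be a virtually nilpotent group with polynomial growth of degree $d$, and let $X$ be any finite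 generating set for $G$. Then $h(G)$ and $g(k)$ are well defined (all nilpotent subgroups of finite index in $G$ have the same Hirsch length, and the maximum $g(k)$ exists for every $k\ge 0$), and for every integer $n\ge 1$, $$s_n(G,X)\ \ge\ \frac{n^d}{2^{d(d+2)}\,g\bigl(h(G)\bigr)^d}\ \ge\ \frac{n^d}{2^{d(d+2)}\,g(d)^d}.$$ -/

import Mathlib

noncomputable section

/-- The ball of radius `n` about the identity: all products of at most `n` elements of
`X ∪ X⁻¹`. -/
def wordBall {G : Type*} [Group G] (X : Set G) (n : ℕ) : Set G :=
  {x | ∃ l : List G, l.length ≤ n ∧ (∀ y ∈ l, y ∈ X ∨ y⁻¹ ∈ X) ∧ l.prod = x}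

/-- The growth function `s_n(G, X)`: the number of elements of the ball of radius `n`
(this ball is finite when `X` is finite). -/
def wordGrowth {G : Type*} [Group G] (X : Set G) (n : ℕ) : ℕ :=
  (wordBall X n).ncard

/-- The real exponents `a` for which there is a constant `C` with `s_n(G, X) ≤ C n ^ a` for every
positive integer `n`. -/
def growthExponents {G : Type*} [Group G] (X : Set G) : Set ℝ :=
  {a | ∃ C : ℝ, ∀ n : ℕ, 1 ≤ n → (wordGrowth X n : ℝ) ≤ C * (n : ℝ) ^ a}

/-- `G` is a finitely generated group with polynomial growth of degree `d`: with respect to some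
finite generating set, the set of admissible growth exponents is nonempty and has infimum `d`.
(The set of exponents is the same for every finite generating set.) -/
def HasGrowthDegree (G : Type*) [Group G] (d : ℝ) : Prop :=
  ∃ S : Set G, S.Finite ∧ Subgroup.closure S = ⊤ ∧
    (growthExponents S).Nonempty ∧ IsGLB (growthExponents S) d

/-- The `i`-th factor of the lower central series of `G`; the series is indexed from `0` here, so
this is the quotient of the `(i+1)`-st term `γ_{i+1}(G)` by `γ_{i+2}(G)`
in the usual indexing. -/
abbrev LowerCentralFactor (G : Type*) [Group G] (i : ℕ) : Type _ :=
  ((⊤ : Subgroup G).lowerCentralSeries i) ⧸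
    ((⊤ : Subgroup G).lowerCentralSeries (i + 1)).subgroupOf
      ((⊤ : Subgroup G).lowerCentralSeries i)

/-- The factors of the lower central series are abelian; the group structure is that of the
quotient group. -/
instance LowerCentralFactor.instCommGroup (G : Type*) [Group G] (i : ℕ) :
    CommGroup (LowerCentralFactor G i) :=
  { (inferInstance : Group (LowerCentralFactor G i)) with
    mul_comm := by
      intro a b
      induction a using QuotientGroup.induction_on with
      | H x =>
        induction b using QuotientGroup.induction_on with
        | H y =>
          refine QuotientGroup.eq.mpr ?_
          rw [Subgroup.mem_subgroupOf, Subgroup.lowerCentralSeries_succ]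
          have h := Subgroup.commutator_mem_commutator
            (inv_mem y.2) (Subgroup.mem_top ((x : G)⁻¹))
          simpa [commutatorElement_def, mul_assoc] using h }

/-- The torsion-free rank of an abelian group: the maximal number of independent elements of
infinite order. -/
def torsionFreeRank (A : Type*) [CommGroup A] : ℕ :=
  Module.finrank ℤ (Additive A)

/-- The Hirsch length of a (finitely generated) nilpotent group: the sum of the torsion-free ranks
of the factors of its lower central series. -/
def nilpotentHirschLength (G : Type*) [Group G] [Group.IsNilpotent G] : ℕ :=
  ∑ i ∈ Finset.range (Group.nilpotencyClass G), torsionFreeRank (LowerCentralFactor G i)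

/-- The Hirsch length of a (finitely generated) virtually nilpotent group: the Hirsch length of its
nilpotent subgroups of finite index. All of them have the same Hirsch length, so the infimum is
that common value. -/
def hirschLength (G : Type*) [Group G] : ℕ :=
  sInf {m | ∃ (H : Subgroup G) (_ : Group.IsNilpotent H),
    H.FiniteIndex ∧ nilpotentHirschLength H = m}

/-- The orders of the finite subgroups of `GL_k(ℤ)`. -/
def finiteSubgroupOrdersGL (k : ℕ) : Set ℕ :=
  {m | ∃ F : Subgroup (Matrix.GeneralLinearGroup (Fin k) ℤ), Finite F ∧ Nat.card F = m}

/-- `g(k)`, the maximal order of a finite subgroup of `GL_k(ℤ)`. -/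
def maxFiniteOrderGL (k : ℕ) : ℕ :=
  sSup (finiteSubgroupOrdersGL k)

end

open Subgroup
open scoped commutatorElement

/-! Write `r_i` for the torsion-free rank of the `i`-th lower central factor, indexed from `0`, of a
nilpotent subgroup of finite index. By the Bass–Guivarc'h formula `d = ∑ (i + 1) r_i`. What must be
controlled is the constant in the lower bound, independently of the generating set.

Take `H` normal, nilpotent and of finite index. Conjugation on the abelianization of `H` modulo
torsion gives `G → GL_r(ℤ)` with `r = r_0 ≤ h(G) ≤ d`. Its kernel `K` contains `H`, so its index `m`
is the order of a finite subgroup of `GL_r(ℤ)`, and `m ≤ g(h(G))` (`exists_subgroup_finite_lcs`).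
Acting trivially modulo torsion on the abelianization, `K` does so on every lower central factor of
`H`, and this forces some `lcs K k` to be finite (`exists_finite_lcs`). The quotient of `K` by it is
nilpotent with the same ranks as `H` (`torsionFreeRank_factor_quotient_lcs_eq`).

In a nilpotent group with these ranks, short representatives of powers of commutators yield `j ^ d`
elements in the ball of radius `2 ^ d * j`, for any finite generating set
(`pow_le_wordGrowth_two_pow_mul`). Since `K` is generated by elements of length at most `2m - 1` in
`G`, `j ^ d ≤ s_{(2m-1) 2^d j}(G, X)`, and rounding `n` down to such a radius gives the stated
constant (`pow_div_le_wordGrowth`).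

That the exponent really is the growth degree needs the matching upper bound, obtained by commutator
collection (`exists_wordGrowth_le`). The maxima `g(k)` exist by Minkowski's reduction modulo `3`,
and Hirsch length is well defined because ranks are unchanged by homomorphisms with finite kernel
and image of finite index (`torsionFreeRank_factor_eq`). -/

/-- The `i`-th term of the lower central series of `G`, indexed from `0`. -/
abbrev lcs (G : Type*) [Group G] (i : ℕ) : Subgroup G := (⊤ : Subgroup G).lowerCentralSeries i

/-! ### Commutator calculus in the lower central series. -/

section LowerCentral

variable {G : Type*} [Group G]

theorem commutator_mem_lcs_succ {i : ℕ} {x : G} (hx : x ∈ lcs G i) (g : G) :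
    ⁅x, g⁆ ∈ lcs G (i + 1) :=
  commutator_mem_commutator hx (mem_top g)

theorem lcs_antitone : Antitone (lcs G) := Subgroup.lowerCentralSeries_antitone _

theorem commute_mk_of_mem_lcs {i : ℕ} {x : G} (hx : x ∈ lcs G i) (g : G ⧸ lcs G (i + 1)) :
    Commute (x : G ⧸ lcs G (i + 1)) g := by
  obtain ⟨g, rfl⟩ := QuotientGroup.mk_surjective g
  rw [← commutatorElement_eq_one_iff_commute]
  exact (QuotientGroup.eq_one_iff _).2 (commutator_mem_lcs_succ hx g)

/-- Commutators with elements of `lcs G i` lie in `lcs G (i + 1)`, which is central modulo `lcs G (i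
+ 2)`. The conjugations in the product identities therefore disappear, and the commutator becomes
bilinear. -/
theorem mk_commutator_mul_left {i : ℕ} {x x' : G} (hx' : x' ∈ lcs G i) (g : G) :
    ((⁅x * x', g⁆ : G) : G ⧸ lcs G (i + 2)) = (⁅x, g⁆ : G) * (⁅x', g⁆ : G) := by
  rw [commutatorElement_mul_left_eq_conj_mul]
  have h := commute_mk_of_mem_lcs (commutator_mem_lcs_succ hx' g)
  simp only [QuotientGroup.mk_mul, QuotientGroup.mk_inv]
  rw [← (h _).eq, mul_inv_cancel_right]
  exact (h _).eq

theorem mk_commutator_mul_right {i : ℕ} {x : G} (hx : x ∈ lcs G i) (g g' : G) :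
    ((⁅x, g * g'⁆ : G) : G ⧸ lcs G (i + 2)) = (⁅x, g⁆ : G) * (⁅x, g'⁆ : G) := by
  rw [commutatorElement_mul_right_eq_mul_conj]
  have h := commute_mk_of_mem_lcs (commutator_mem_lcs_succ hx g')
  simp only [QuotientGroup.mk_mul, QuotientGroup.mk_inv]
  rw [mul_assoc, mul_assoc, (h _).eq, mul_inv_cancel_left]

/-- For `x` in the `i`-th term, `g ↦ ⁅x, g⁆` is a homomorphism modulo the `i + 2`-nd term. -/
def commRight {i : ℕ} (x : lcs G i) : G →* G ⧸ lcs G (i + 2) :=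
  MonoidHom.mk' (fun g => ((⁅(x : G), g⁆ : G) : G ⧸ lcs G (i + 2)))
    fun g g' => mk_commutator_mul_right x.2 g g'

/-- On the `i`-th term, `x ↦ ⁅x, g⁆` is a homomorphism modulo the `i + 2`-nd term. -/
def commLeft (i : ℕ) (g : G) : lcs G i →* G ⧸ lcs G (i + 2) :=
  MonoidHom.mk' (fun x => ((⁅(x : G), g⁆ : G) : G ⧸ lcs G (i + 2)))
    fun _ x' => mk_commutator_mul_left x'.2 g

theorem mk_commutator_pow_left {i : ℕ} {x : G} (hx : x ∈ lcs G i) (g : G) (n : ℕ) :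
    ((⁅x ^ n, g⁆ : G) : G ⧸ lcs G (i + 2)) = (⁅x, g⁆ : G) ^ n :=
  map_pow (commLeft i g) ⟨x, hx⟩ n

theorem mk_commutator_pow_right {i : ℕ} {x : G} (hx : x ∈ lcs G i) (g : G) (n : ℕ) :
    ((⁅x, g ^ n⁆ : G) : G ⧸ lcs G (i + 2)) = (⁅x, g⁆ : G) ^ n :=
  map_pow (commRight ⟨x, hx⟩) g n

/-- The three subgroups lemma, applied in the quotient by `N`. -/
theorem commutator_commutator_le_of_rotate {H₁ H₂ H₃ N : Subgroup G} [N.Normal]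
    (h₁ : ⁅⁅H₂, H₃⁆, H₁⁆ ≤ N) (h₂ : ⁅⁅H₃, H₁⁆, H₂⁆ ≤ N) : ⁅⁅H₁, H₂⁆, H₃⁆ ≤ N := by
  have key : ∀ K : Subgroup G, K ≤ N ↔ K.map (QuotientGroup.mk' N) = ⊥ := fun K => by
    rw [Subgroup.map_eq_bot_iff, QuotientGroup.ker_mk']
  rw [key, map_commutator, map_commutator] at *
  exact commutator_commutator_eq_bot_of_rotate h₁ h₂

theorem commutator_lcs_le (i j : ℕ) : ⁅lcs G i, lcs G j⁆ ≤ lcs G (i + j + 1) := by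
  induction j generalizing i with
  | zero => exact le_rfl
  | succ j ih =>
    rw [commutator_comm]
    refine commutator_commutator_le_of_rotate (H₁ := lcs G j) (H₂ := ⊤) (H₃ := lcs G i) ?_ ?_
    · rw [commutator_comm ⊤]
      have := ih (i + 1)
      rwa [show i + 1 + j + 1 = i + (j + 1) + 1 by ring] at this
    · exact commutator_mono (ih i) le_rfl

theorem commutator_mem_lcs {i j : ℕ} {x y : G} (hx : x ∈ lcs G i) (hy : y ∈ lcs G j) :
    ⁅x, y⁆ ∈ lcs G (i + j + 1) :=
  commutator_lcs_le i j (commutator_mem_commutator hx hy)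

/-- The left-normed commutators of weight `i + 1` in the elements of `Y`. -/
def leftComms (Y : Set G) : ℕ → Set G
  | 0 => Y
  | i + 1 => {z | ∃ x ∈ leftComms Y i, ∃ y ∈ Y, ⁅x, y⁆ = z}

theorem leftComms_subset (Y : Set G) (i : ℕ) : leftComms Y i ⊆ lcs G i := by
  induction i with
  | zero => intro x _; exact mem_top x
  | succ i ih =>
    rintro _ ⟨x, hx, y, -, rfl⟩
    exact commutator_mem_lcs_succ (ih hx) y

theorem leftComms_finite {Y : Set G} (hY : Y.Finite) (i : ℕ) : (leftComms Y i).Finite := by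
  induction i with
  | zero => exact hY
  | succ i ih => exact (ih.image2 (fun x y => ⁅x, y⁆) hY).subset fun z hz => hz

/-- By bilinearity modulo the next term, first the right entry of a commutator is reduced to
generators in `Y` (`commRight`), then the left entry to left-normed commutators of lower weight
(`commLeft`). -/
theorem lcs_le_closure_leftComms_sup {Y : Set G} (hY : closure Y = ⊤) (i : ℕ) :
    lcs G i ≤ closure (leftComms Y i) ⊔ lcs G (i + 1) := by
  induction i with
  | zero => simp [leftComms, hY]
  | succ i ih =>
    set K := closure (leftComms Y (i + 1)) ⊔ lcs G (i + 2) with hK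
    have hker : (QuotientGroup.mk' (lcs G (i + 2))).ker ≤ K := by
      rw [QuotientGroup.ker_mk']; exact le_sup_right
    have mem : ∀ z : G, (z : G ⧸ lcs G (i + 2)) ∈ K.map (QuotientGroup.mk' (lcs G (i + 2))) →
        z ∈ K := fun z hz => by
      have : z ∈ (K.map (QuotientGroup.mk' (lcs G (i + 2)))).comap
          (QuotientGroup.mk' (lcs G (i + 2))) := hz
      rwa [comap_map_eq, sup_eq_left.2 hker] at this
    have h₁ : ∀ x ∈ leftComms Y i, ∀ g, ⁅x, g⁆ ∈ K := by
      intro x hx g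
      have : (⊤ : Subgroup G) ≤ (K.map (QuotientGroup.mk' (lcs G (i + 2)))).comap
          (commRight ⟨x, leftComms_subset Y i hx⟩) := by
        refine hY.symm.le.trans ((closure_le _).2 ?_)
        intro y hy
        exact ⟨⁅x, y⁆, mem_sup_left (subset_closure ⟨x, hx, y, hy, rfl⟩), rfl⟩
      exact mem _ (this (mem_top g))
    refine commutator_le.2 fun x hx g _ => ?_
    obtain ⟨x', hx', z, hz, rfl⟩ := mem_sup_of_normal_right.1 (ih hx)
    have hle : closure (leftComms Y i) ≤ lcs G i := (closure_le _).2 (leftComms_subset Y i)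
    have h₂ : closure (leftComms Y i) ≤
        ((K.map (QuotientGroup.mk' (lcs G (i + 2)))).comap (commLeft i g)).map (lcs G i).subtype := by
      rw [closure_le]
      intro y hy
      exact ⟨⟨y, leftComms_subset Y i hy⟩, ⟨⁅y, g⁆, h₁ y hy g, rfl⟩, rfl⟩
    apply mem
    rw [mk_commutator_mul_left (lcs_antitone (Nat.le_succ i) hz)]
    refine mul_mem ?_ ?_
    · obtain ⟨w, hw, rfl⟩ := h₂ hx'
      exact hw
    · exact ⟨_, mem_sup_right (commutator_mem_lcs_succ hz g), rfl⟩

end LowerCentral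

/-! ### Ranks of finitely generated abelian groups. -/

section RankLemmas

variable {M N : Type*} [AddCommGroup M] [AddCommGroup N]

theorem finrank_eq_of_torsion_ker_coker [Module.Finite ℤ N] (f : M →ₗ[ℤ] N)
    (hker : ∀ x, f x = 0 → ∃ n : ℕ, 0 < n ∧ n • x = 0)
    (hcoker : ∀ y, ∃ n : ℕ, 0 < n ∧ ∃ x, f x = n • y) :
    Module.finrank ℤ M = Module.finrank ℤ N := by
  have h₁ : Module.finrank ℤ (M ⧸ LinearMap.ker f) = Module.finrank ℤ M := by
    refine finrank_quotient_eq_of_le_torsion fun x hx => ?_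
    obtain ⟨n, hn, h⟩ := hker x hx
    exact ⟨⟨(n : ℤ), by simpa using hn.ne'⟩, by
      rw [Submonoid.mk_smul, natCast_zsmul]; exact h⟩
  have h₂ : Module.finrank ℤ (N ⧸ LinearMap.range f) = 0 := by
    rw [Module.finrank_eq_zero_iff_isTorsion]
    intro y
    obtain ⟨y, rfl⟩ := Submodule.Quotient.mk_surjective _ y
    obtain ⟨n, hn, x, h⟩ := hcoker y
    refine ⟨⟨(n : ℤ), by simpa using hn.ne'⟩, ?_⟩
    rw [Submonoid.mk_smul, natCast_zsmul, ← Submodule.Quotient.mk_smul,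
      Submodule.Quotient.mk_eq_zero]
    exact ⟨x, h⟩
  rw [← h₁, f.quotKerEquivRange.finrank_eq, ← (LinearMap.range f).finrank_quotient_add_finrank, h₂,
    zero_add]

/-- Maximality of an independent subfamily makes every other vector torsion modulo its span, so the
span has full rank. -/
theorem exists_linearIndepOn_ncard_eq_finrank {ι : Type*} [Finite ι] (v : ι → M)
    (hv : Submodule.span ℤ (Set.range v) = ⊤) :
    ∃ I : Set ι, LinearIndepOn ℤ v I ∧ I.ncard = Module.finrank ℤ M ∧
      ∀ i, ∃ a : ℕ, 0 < a ∧ a • v i ∈ Submodule.span ℤ (v '' I) := by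
  have : Module.Finite ℤ M := ⟨by
    rw [← hv]; exact Submodule.fg_span (Set.finite_range v)⟩
  obtain ⟨I, hI, hmax⟩ := exists_maximal_linearIndepOn ℤ v
  have h₁ : ∀ i, ∃ a : ℕ, 0 < a ∧ a • v i ∈ Submodule.span ℤ (v '' I) := by
    intro i
    by_cases hi : i ∈ I
    · exact ⟨1, one_pos, by simpa using Submodule.subset_span (Set.mem_image_of_mem v hi)⟩
    · obtain ⟨a, ha, h⟩ := hmax i hi
      refine ⟨a.natAbs, Int.natAbs_pos.2 ha, ?_⟩
      rw [← natCast_zsmul]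
      rcases Int.natAbs_eq a with h' | h'
      · rwa [← h']
      · rw [← neg_eq_iff_eq_neg.2 h', neg_smul]; exact neg_mem h
  refine ⟨I, hI, ?_, h₁⟩
  set S := Submodule.span ℤ (v '' I) with hS
  have htors : Module.IsTorsion ℤ (M ⧸ S) := by
    suffices h : (⊤ : Submodule ℤ (M ⧸ S)) ≤ Submodule.torsion ℤ (M ⧸ S) from
      fun {x} => (Submodule.mem_torsion_iff x).1 (h (Submodule.mem_top (x := x)))
    rw [← Submodule.range_mkQ S, LinearMap.range_eq_map, ← hv, Submodule.map_span,
      Submodule.span_le]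
    rintro _ ⟨_, ⟨i, rfl⟩, rfl⟩
    obtain ⟨a, ha, h⟩ := h₁ i
    refine ⟨⟨(a : ℤ), by simpa using ha.ne'⟩, ?_⟩
    rw [Submonoid.mk_smul, natCast_zsmul, ← map_nsmul, Submodule.mkQ_apply,
      Submodule.Quotient.mk_eq_zero]
    exact h
  have h₂ := S.finrank_quotient_add_finrank
  rw [Module.finrank_eq_zero_iff_isTorsion.2 htors, zero_add] at h₂
  have : Fintype I := Fintype.ofFinite I
  have h₃ := finrank_span_eq_card (R := ℤ) (b := fun i : I => v i) hI
  rw [← h₂, hS, Set.image_eq_range, h₃, ← Nat.card_coe_set_eq, Nat.card_eq_fintype_card]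

end RankLemmas

/-! ### Lower central factors: functoriality, generators, rank. -/

section Factors

variable {G G' : Type*} [Group G] [Group G']

/-- The class in the `i`-th lower central factor. -/
def factorMk (i : ℕ) : lcs G i →* LowerCentralFactor G i := QuotientGroup.mk' _

theorem factorMk_surjective (i : ℕ) : Function.Surjective (factorMk (G := G) i) :=
  QuotientGroup.mk'_surjective _

theorem factorMk_eq_one_iff {i : ℕ} (x : lcs G i) : factorMk i x = 1 ↔ (x : G) ∈ lcs G (i + 1) := by
  rw [← mem_subgroupOf (H := lcs G (i + 1)) (K := lcs G i)]
  exact QuotientGroup.eq_one_iff x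

theorem factorMk_eq_iff {i : ℕ} (x y : lcs G i) :
    factorMk i x = factorMk i y ↔ (x : G)⁻¹ * y ∈ lcs G (i + 1) := by
  rw [eq_comm, ← inv_mul_eq_one, ← map_inv, ← map_mul, ← inv_mem_iff, factorMk_eq_one_iff]
  simp

theorem map_mem_lcs (φ : G →* G') {i : ℕ} {x : G} (hx : x ∈ lcs G i) : φ x ∈ lcs G' i := by
  have : φ x ∈ (lcs G i).map φ := mem_map_of_mem φ hx
  rw [map_lowerCentralSeries] at this
  exact lowerCentralSeries_mono i le_top this

/-- The homomorphism of lower central terms induced by a group homomorphism. -/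
def lcsMap (φ : G →* G') (i : ℕ) : lcs G i →* lcs G' i :=
  (φ.comp (lcs G i).subtype).codRestrict (lcs G' i) fun x => map_mem_lcs φ x.2

/-- The homomorphism of lower central factors induced by a group homomorphism. -/
def factorMap (φ : G →* G') (i : ℕ) : LowerCentralFactor G i →* LowerCentralFactor G' i :=
  QuotientGroup.lift _ ((factorMk i).comp (lcsMap φ i)) fun x hx => by
    rw [mem_subgroupOf] at hx
    exact (factorMk_eq_one_iff _).2 (map_mem_lcs φ hx)

theorem factorMap_mk (φ : G →* G') (i : ℕ) (x : lcs G i) :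
    factorMap φ i (factorMk i x) = factorMk i (lcsMap φ i x) := rfl

theorem factorMap_id (i : ℕ) : factorMap (MonoidHom.id G) i = MonoidHom.id _ := by
  refine MonoidHom.ext fun x => ?_
  obtain ⟨x, rfl⟩ := factorMk_surjective i x
  rfl

theorem factorMap_comp {G'' : Type*} [Group G''] (ψ : G' →* G'') (φ : G →* G') (i : ℕ) :
    factorMap (ψ.comp φ) i = (factorMap ψ i).comp (factorMap φ i) := by
  refine MonoidHom.ext fun x => ?_
  obtain ⟨x, rfl⟩ := factorMk_surjective i x
  rfl

theorem closure_factorMk_eq_top {Y : Set G} (hY : closure Y = ⊤) {i : ℕ} {S : Set G}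
    (hS : leftComms Y i ⊆ S) :
    closure (factorMk i '' {x : lcs G i | (x : G) ∈ S}) = ⊤ := by
  rw [eq_top_iff]
  intro z _
  obtain ⟨x, rfl⟩ := factorMk_surjective i z
  obtain ⟨y, hy, w, hw, h⟩ := mem_sup_of_normal_right.1 (lcs_le_closure_leftComms_sup hY i x.2)
  have hle : closure (leftComms Y i) ≤
      (closure {x : lcs G i | (x : G) ∈ S}).map (lcs G i).subtype := by
    rw [closure_le]
    intro u hu
    exact ⟨⟨u, leftComms_subset Y i hu⟩, subset_closure (hS hu), rfl⟩
  obtain ⟨y', hy', rfl⟩ := hle hy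
  have : factorMk i x = factorMk i y' := by
    rw [eq_comm, factorMk_eq_iff, ← h]
    simpa using hw
  rw [this, ← MonoidHom.map_closure]
  exact mem_map_of_mem _ hy'

theorem span_factor_eq_top {Y : Set G} (hY : closure Y = ⊤) {i : ℕ} {S : Set G}
    (hS : leftComms Y i ⊆ S) (hS' : S ⊆ lcs G i) :
    Submodule.span ℤ (Set.range fun s : S =>
      Additive.ofMul (factorMk i ⟨(s : G), hS' s.2⟩)) = ⊤ := by
  rw [eq_top_iff]
  intro z _
  have hz : Additive.toMul z ∈ closure (factorMk i '' {x : lcs G i | (x : G) ∈ S}) := by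
    rw [closure_factorMk_eq_top hY hS]; exact mem_top _
  have : ∀ w ∈ closure (factorMk i '' {x : lcs G i | (x : G) ∈ S}), Additive.ofMul w ∈
      Submodule.span ℤ (Set.range fun s : S =>
        Additive.ofMul (factorMk i ⟨(s : G), hS' s.2⟩)) := by
    intro w hw
    induction hw using closure_induction with
    | mem x hx =>
      obtain ⟨x, hx, rfl⟩ := hx
      exact Submodule.subset_span ⟨⟨x, hx⟩, rfl⟩
    | one => exact zero_mem _
    | mul x y _ _ hx hy => exact add_mem hx hy
    | inv x _ hx => exact neg_mem hx
  exact this _ hz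

theorem finite_additive_factor [Group.FG G] (i : ℕ) :
    Module.Finite ℤ (Additive (LowerCentralFactor G i)) := by
  obtain ⟨Y, hY, hfin⟩ := Group.fg_iff.1 (inferInstance : Group.FG G)
  have := (leftComms_finite hfin i).to_subtype
  exact ⟨by
    rw [← span_factor_eq_top hY (subset_refl _) (leftComms_subset Y i)]
    exact Submodule.fg_span (Set.finite_range _)⟩

theorem torsionFreeRank_eq_of_torsion_ker_coker {A B : Type*} [CommGroup A] [CommGroup B]
    [Module.Finite ℤ (Additive B)] (f : A →* B)
    (hker : ∀ x, f x = 1 → ∃ n : ℕ, 0 < n ∧ x ^ n = 1)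
    (hcoker : ∀ y, ∃ n : ℕ, 0 < n ∧ ∃ x, f x = y ^ n) :
    torsionFreeRank A = torsionFreeRank B :=
  finrank_eq_of_torsion_ker_coker (MonoidHom.toAdditive f).toIntLinearMap hker hcoker

theorem torsionFreeRank_eq_zero_iff {A : Type*} [CommGroup A] [Module.Finite ℤ (Additive A)] :
    torsionFreeRank A = 0 ↔ ∀ x : A, ∃ n : ℕ, 0 < n ∧ x ^ n = 1 := by
  rw [torsionFreeRank, Module.finrank_eq_zero_iff_isTorsion]
  constructor
  · intro h x
    obtain ⟨⟨a, ha⟩, h⟩ := @h (Additive.ofMul x)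
    refine ⟨a.natAbs, Int.natAbs_pos.2 (by simpa using ha), ?_⟩
    have h' : x ^ a = 1 := h
    rcases Int.natAbs_eq a with e | e
    · rw [e] at h'; simpa using h'
    · rw [e] at h'; simpa using h'
  · intro h x
    obtain ⟨n, hn, h⟩ := h x.toMul
    exact ⟨⟨(n : ℤ), by simpa using hn.ne'⟩, by
      rw [Submonoid.mk_smul, natCast_zsmul]; exact h⟩

/-- If `x ^ n` vanishes in factor `i`, then bilinearity kills `⁅x, y⁆ ^ n` in the next factor. Once
a rank is zero all later ones are, which the estimate of the constant `2 ^ D` relies on. -/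
theorem torsionFreeRank_factor_succ_eq_zero [Group.FG G] {i : ℕ}
    (h : torsionFreeRank (LowerCentralFactor G i) = 0) :
    torsionFreeRank (LowerCentralFactor G (i + 1)) = 0 := by
  have := finite_additive_factor (G := G) i
  have := finite_additive_factor (G := G) (i + 1)
  rw [torsionFreeRank_eq_zero_iff] at h ⊢
  intro z
  obtain ⟨z, rfl⟩ := factorMk_surjective _ z
  obtain ⟨Y, hY, hfin⟩ := Group.fg_iff.1 (inferInstance : Group.FG G)
  have hz : factorMk (i + 1) z ∈ closure (factorMk (i + 1) ''
      {x : lcs G (i + 1) | (x : G) ∈ leftComms Y (i + 1)}) := by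
    rw [closure_factorMk_eq_top hY (subset_refl _)]; exact mem_top _
  generalize factorMk (i + 1) z = w at hz
  induction hz using closure_induction with
  | mem x hx =>
    obtain ⟨⟨_, hx'⟩, ⟨x, hx, y, hy, rfl⟩, rfl⟩ := hx
    have hx₁ := leftComms_subset Y i hx
    obtain ⟨n, hn, hxn⟩ := h (factorMk i ⟨x, hx₁⟩)
    refine ⟨n, hn, ?_⟩
    rw [← map_pow, factorMk_eq_one_iff] at hxn ⊢
    have := commutator_mem_lcs_succ hxn y
    rw [← QuotientGroup.eq_one_iff] at this ⊢
    exact (mk_commutator_pow_left hx₁ y n).symm.trans this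
  | one => exact ⟨1, one_pos, one_pow 1⟩
  | mul x y _ _ hx hy =>
    obtain ⟨n, hn, hx⟩ := hx
    obtain ⟨m, hm, hy⟩ := hy
    exact ⟨n * m, Nat.mul_pos hn hm, by
      rw [mul_pow, pow_mul, hx, mul_comm n, pow_mul, hy, one_pow, one_pow, one_mul]⟩
  | inv x _ hx =>
    obtain ⟨n, hn, hx⟩ := hx
    exact ⟨n, hn, by rw [inv_pow, hx, inv_one]⟩

end Factors

/-! ### Invariance of ranks and Hirsch length under finite index and finite kernels. -/

section Commensurability

variable {Q : Type*} [Group Q]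

theorem mem_of_mk_mem_map {N K : Subgroup Q} [N.Normal] (h : N ≤ K) {z : Q}
    (hz : (z : Q ⧸ N) ∈ K.map (QuotientGroup.mk' N)) : z ∈ K := by
  have : z ∈ (K.map (QuotientGroup.mk' N)).comap (QuotientGroup.mk' N) := hz
  rwa [comap_map_eq, QuotientGroup.ker_mk', sup_eq_left.2 h] at this

/-- The inductive step is `⁅x, g⁆ ^ (m * n) ≡ ⁅x ^ n, g ^ m⁆`, where `x ^ n` and `g ^ m` have been
moved into `R` modulo higher terms. -/
theorem exists_pow_mem_lcs_sup {R : Subgroup Q} {m : ℕ} (hm : 0 < m) (hR : ∀ x, x ^ m ∈ R) (i : ℕ) :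
    ∀ x ∈ lcs Q i, ∃ n : ℕ, 0 < n ∧ x ^ n ∈ R.lowerCentralSeries i ⊔ lcs Q (i + 1) := by
  induction i with
  | zero => exact fun x _ => ⟨m, hm, mem_sup_left (hR x)⟩
  | succ i ih =>
    intro x hx
    have hle : lcs Q (i + 2) ≤ R.lowerCentralSeries (i + 1) ⊔ lcs Q (i + 2) := le_sup_right
    have hx' : x ∈ closure {z | ∃ p ∈ lcs Q i, ∃ q ∈ (⊤ : Subgroup Q), ⁅p, q⁆ = z} := hx
    clear hx
    induction hx' using closure_induction with
    | mem x h =>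
      obtain ⟨x, hx, g, -, rfl⟩ := h
      obtain ⟨n, hn, hxn⟩ := ih x hx
      obtain ⟨r, hr, z, hz, h⟩ := mem_sup_of_normal_right.1 hxn
      refine ⟨m * n, Nat.mul_pos hm hn, mem_of_mk_mem_map hle ?_⟩
      have e : ((⁅x, g⁆ ^ (m * n) : Q) : Q ⧸ lcs Q (i + 2)) =
          (⁅r, g ^ m⁆ : Q) * (⁅z, g ^ m⁆ : Q) := by
        rw [← mk_commutator_mul_left (lcs_antitone (Nat.le_succ i) hz), h,
          mk_commutator_pow_left hx, mk_commutator_pow_right hx, ← pow_mul]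
        rfl
      rw [e]
      refine mul_mem ⟨_, mem_sup_left (commutator_mem_commutator hr (hR g)), rfl⟩
        ⟨_, mem_sup_right (commutator_mem_lcs_succ hz _), rfl⟩
    | one => exact ⟨1, one_pos, by simp⟩
    | mul x y hx' hy' hx hy =>
      obtain ⟨n, hn, hx⟩ := hx
      obtain ⟨k, hk, hy⟩ := hy
      refine ⟨n * k, Nat.mul_pos hn hk, mem_of_mk_mem_map hle ?_⟩
      have hc : Commute (x : Q ⧸ lcs Q (i + 2)) y := commute_mk_of_mem_lcs (i := i + 1) hx' _
      rw [QuotientGroup.mk_pow, QuotientGroup.mk_mul, hc.mul_pow, pow_mul, mul_comm n k, pow_mul]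
      exact mul_mem (pow_mem (mem_map_of_mem (QuotientGroup.mk' _) hx) _)
        (pow_mem (mem_map_of_mem (QuotientGroup.mk' _) hy) _)
    | inv x hx' hx =>
      obtain ⟨n, hn, hx⟩ := hx
      exact ⟨n, hn, by rw [inv_pow]; exact inv_mem hx⟩

/-- Downward induction from the trivial term. Each factor modulo the image of the corresponding term
of `R` is a finitely generated abelian torsion group, hence finite, and its representatives multiply
the finite set for the next term. -/
theorem exists_finite_lcs_subset_mul [Group.FG Q] [Group.IsNilpotent Q] {R : Subgroup Q} {m : ℕ}
    (hm : 0 < m) (hR : ∀ x, x ^ m ∈ R) (i : ℕ) :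
    ∃ T : Set Q, T.Finite ∧ ∀ x ∈ lcs Q i, ∃ t ∈ T, t⁻¹ * x ∈ R.lowerCentralSeries i := by
  obtain ⟨c, hc⟩ := Subgroup.nilpotent_iff_lowerCentralSeries.1 (inferInstance : Group.IsNilpotent Q)
  by_cases hi : c ≤ i
  · refine ⟨{1}, Set.finite_singleton 1, fun x hx => ⟨1, rfl, ?_⟩⟩
    have : x ∈ (⊥ : Subgroup Q) := hc ▸ lcs_antitone hi hx
    rw [mem_bot.1 this]; simp
  refine Nat.decreasingInduction' (P := fun i => ∃ T : Set Q, T.Finite ∧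
    ∀ x ∈ lcs Q i, ∃ t ∈ T, t⁻¹ * x ∈ R.lowerCentralSeries i) ?_ (not_le.1 hi).le ?_
  · rintro i - - ⟨T, hT, h⟩
    set S : Subgroup (LowerCentralFactor Q i) :=
      ((R.lowerCentralSeries i).subgroupOf (lcs Q i)).map (factorMk i) with hS
    have hfin := finite_additive_factor (G := Q) i
    have hfg : Group.FG (LowerCentralFactor Q i) := by
      rw [GroupFG.iff_add_fg]
      exact Module.Finite.iff_addGroup_fg.1 hfin
    have : Finite (LowerCentralFactor Q i ⧸ S) := by
      refine CommGroup.finite_of_fg_isMulTorsion _ ?_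
      intro z
      obtain ⟨z, rfl⟩ := QuotientGroup.mk_surjective z
      obtain ⟨x, rfl⟩ := factorMk_surjective i z
      obtain ⟨n, hn, hx⟩ := exists_pow_mem_lcs_sup hm hR i x x.2
      rw [isOfFinOrder_iff_pow_eq_one]
      refine ⟨n, hn, ?_⟩
      rw [← QuotientGroup.mk_pow, QuotientGroup.eq_one_iff, ← map_pow]
      obtain ⟨r, hr, w, hw, h⟩ := mem_sup_of_normal_right.1 hx
      have hr' : r ∈ lcs Q i := lowerCentralSeries_mono i le_top hr
      refine ⟨⟨r, hr'⟩, hr, ?_⟩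
      rw [factorMk_eq_iff]
      change r⁻¹ * (x : Q) ^ n ∈ _
      rw [← h]; simpa using hw
    choose f hf using fun z : LowerCentralFactor Q i ⧸ S =>
      (show ∃ x : lcs Q i, (QuotientGroup.mk (factorMk i x) : LowerCentralFactor Q i ⧸ S) = z from by
        obtain ⟨z, rfl⟩ := QuotientGroup.mk_surjective z
        obtain ⟨x, rfl⟩ := factorMk_surjective i z
        exact ⟨x, rfl⟩)
    refine ⟨_, (Set.finite_range fun z => (f z : Q)).image2 (· * ·) hT, fun x hx => ?_⟩
    have h₁ := hf (QuotientGroup.mk (factorMk i ⟨x, hx⟩))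
    set y := f (QuotientGroup.mk (factorMk i ⟨x, hx⟩)) with hy
    obtain ⟨r, hr, h₂⟩ := QuotientGroup.eq.1 h₁
    rw [← map_inv, ← map_mul, factorMk_eq_iff] at h₂
    set z : Q := (r : Q)⁻¹ * ((y : Q)⁻¹ * x) with hz
    have h₂' : z ∈ lcs Q (i + 1) := h₂
    -- From `x = y * r * z` one gets `x = y * (r * z * r⁻¹) * r`: the remainder of higher weight is
    -- moved next to `y`, and `r`, which lies in the term of `R`, stays on the right.
    have h₃ : r * z * (r : Q)⁻¹ ∈ lcs Q (i + 1) :=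
      (inferInstance : (lcs Q (i + 1)).Normal).conj_mem z h₂' r
    obtain ⟨t, ht, h₄⟩ := h _ h₃
    refine ⟨_, ⟨y, ⟨_, rfl⟩, t, ht, rfl⟩, ?_⟩
    have h₅ : t⁻¹ * (r * z * (r : Q)⁻¹) * r ∈ R.lowerCentralSeries i :=
      mul_mem (R.lowerCentralSeries_antitone (Nat.le_succ i) h₄) hr
    convert h₅ using 1
    rw [hz]; group
  · refine ⟨{1}, Set.finite_singleton 1, fun x hx => ⟨1, rfl, ?_⟩⟩
    have : x ∈ (⊥ : Subgroup Q) := hc ▸ hx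
    rw [mem_bot.1 this]; simp

/-- Pigeonhole: two of the powers of `x` lie in the same of finitely many left cosets. -/
theorem exists_pow_mem_lowerCentralSeries [Group.FG Q] [Group.IsNilpotent Q] (R : Subgroup Q)
    [hR : R.FiniteIndex] {i : ℕ} {x : Q} (hx : x ∈ lcs Q i) :
    ∃ n : ℕ, 0 < n ∧ x ^ n ∈ R.lowerCentralSeries i := by
  obtain ⟨T, hT, h⟩ := exists_finite_lcs_subset_mul (Nat.factorial_pos R.index)
    (fun x => R.pow_mem_of_index_ne_zero_of_dvd hR.index_ne_zero x
      fun m h₀ hm => Nat.dvd_factorial h₀ hm) i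
  have := hT.to_subtype
  choose f hf hf' using fun n : ℕ => h _ (pow_mem hx n)
  obtain ⟨a, b, hab, e⟩ : ∃ a b, a ≠ b ∧ f a = f b := by
    obtain ⟨a, b, hab, e⟩ := Finite.exists_ne_map_eq_of_infinite fun n => (⟨f n, hf n⟩ : T)
    exact ⟨a, b, hab, congrArg Subtype.val e⟩
  wlog hlt : a < b generalizing a b
  · exact this b a hab.symm e.symm (lt_of_le_of_ne (not_lt.1 hlt) hab.symm)
  refine ⟨b - a, Nat.sub_pos_of_lt hlt, ?_⟩
  have h₁ := mul_mem (inv_mem (hf' a)) (hf' b)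
  rw [e, mul_inv_rev, inv_inv, mul_assoc, mul_inv_cancel_left] at h₁
  rwa [pow_sub _ hlt.le, ← inv_pow, (Commute.refl x).inv_right.pow_pow b a |>.eq, inv_pow]

/-- Elements of a term of `Q` have powers in the same term of the image, so the induced map of
factors has torsion cokernel. Its kernel is torsion too, since the ambiguity in lifting such a power
lies in the finite group `φ.ker`. -/
theorem torsionFreeRank_factor_eq {H : Type*} [Group H] [Group.FG Q] [Group.IsNilpotent Q]
    (φ : H →* Q) [Finite φ.ker] [φ.range.FiniteIndex] (i : ℕ) :
    torsionFreeRank (LowerCentralFactor H i) = torsionFreeRank (LowerCentralFactor Q i) := by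
  have := finite_additive_factor (G := Q) i
  have hmap : ∀ j, φ.range.lowerCentralSeries j = (lcs H j).map φ := fun j => by
    rw [map_lowerCentralSeries, ← MonoidHom.range_eq_map]
  refine torsionFreeRank_eq_of_torsion_ker_coker (factorMap φ i) (fun x hx => ?_) fun y => ?_
  · obtain ⟨x, rfl⟩ := factorMk_surjective i x
    rw [factorMap_mk, factorMk_eq_one_iff] at hx
    obtain ⟨n, hn, h⟩ := exists_pow_mem_lowerCentralSeries φ.range hx
    rw [hmap] at h
    obtain ⟨z, hz, h⟩ := h
    have h' : φ z = φ ((x : H) ^ n) := h.trans (map_pow φ (x : H) n).symm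
    have hk : (z : H)⁻¹ * (x : H) ^ n ∈ φ.ker := by
      rw [MonoidHom.mem_ker, map_mul, map_inv, h', inv_mul_cancel]
    set k : φ.ker := ⟨_, hk⟩ with hkdef
    obtain ⟨a, ha, hka⟩ := isOfFinOrder_iff_pow_eq_one.1 (isOfFinOrder_of_finite k)
    refine ⟨n * a, Nat.mul_pos hn ha, ?_⟩
    have hz' : z ∈ lcs H i := lcs_antitone (Nat.le_succ i) hz
    have e : factorMk i x ^ n = factorMk i (⟨z, hz'⟩⁻¹ * x ^ n) := by
      rw [map_mul, map_inv, (factorMk_eq_one_iff ⟨z, hz'⟩).2 hz, inv_one, one_mul, map_pow]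
    rw [pow_mul, e, ← map_pow]
    have : (⟨z, hz'⟩⁻¹ * x ^ n : lcs H i) ^ a = 1 :=
      Subtype.ext (by simpa [hkdef] using congrArg Subtype.val hka)
    rw [this, map_one]
  · obtain ⟨y, rfl⟩ := factorMk_surjective i y
    obtain ⟨n, hn, h⟩ := exists_pow_mem_lowerCentralSeries φ.range y.2
    rw [hmap] at h
    obtain ⟨x, hx, h⟩ := h
    exact ⟨n, hn, factorMk i ⟨x, hx⟩, by
      rw [factorMap_mk, ← map_pow]; exact congrArg _ (Subtype.ext h)⟩

theorem torsionFreeRank_factor_eq_zero {i : ℕ} (h : lcs Q i = ⊥) :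
    torsionFreeRank (LowerCentralFactor Q i) = 0 := by
  have : Subsingleton (lcs Q i) := by rw [h]; infer_instance
  have : Subsingleton (Additive (LowerCentralFactor Q i)) :=
    (factorMk_surjective (G := Q) i).subsingleton
  exact Module.finrank_zero_of_subsingleton

theorem nilpotentHirschLength_eq_sum [Group.IsNilpotent Q] {n : ℕ}
    (hn : Group.nilpotencyClass Q ≤ n) :
    nilpotentHirschLength Q = ∑ i ∈ Finset.range n, torsionFreeRank (LowerCentralFactor Q i) := by
  refine Finset.sum_subset (Finset.range_mono hn) fun i _ hi => ?_
  refine torsionFreeRank_factor_eq_zero (Subgroup.lowerCentralSeries_eq_bot_iff_nilpotencyClass_le.2 ?_)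
  simpa using hi

theorem nilpotentHirschLength_eq_of_hom {H : Type*} [Group H] [Group.IsNilpotent H] [Group.FG Q]
    [Group.IsNilpotent Q] (φ : H →* Q) [Finite φ.ker] [φ.range.FiniteIndex] :
    nilpotentHirschLength H = nilpotentHirschLength Q := by
  rw [nilpotentHirschLength_eq_sum (le_max_left _ (Group.nilpotencyClass Q)),
    nilpotentHirschLength_eq_sum (le_max_right (Group.nilpotencyClass H) _)]
  exact Finset.sum_congr rfl fun i _ => torsionFreeRank_factor_eq φ i

theorem nilpotentHirschLength_eq_of_finiteIndex [Group.FG Q] (H K : Subgroup Q)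
    [Group.IsNilpotent H] [Group.IsNilpotent K] [H.FiniteIndex] [K.FiniteIndex] :
    nilpotentHirschLength H = nilpotentHirschLength K := by
  have key : ∀ (H L : Subgroup Q) [Group.IsNilpotent H] [Group.IsNilpotent L] [L.FiniteIndex]
      [H.FiniteIndex], L ≤ H → nilpotentHirschLength L = nilpotentHirschLength H := by
    intro H L _ _ _ _ h
    have : Finite (inclusion h).ker := by
      rw [(MonoidHom.ker_eq_bot_iff _).2 (inclusion_injective h)]; infer_instance
    have : (inclusion h).range.FiniteIndex := by
      rw [inclusion_range]; infer_instance
    exact nilpotentHirschLength_eq_of_hom (inclusion h)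
  have : Group.IsNilpotent (H ⊓ K : Subgroup Q) := by
    have h := Subgroup.isNilpotent ((H ⊓ K).subgroupOf H)
    exact Group.nilpotent_of_mulEquiv (subgroupOfEquivOfLe inf_le_left)
  rw [← key H (H ⊓ K) inf_le_left, key K (H ⊓ K) inf_le_right]

theorem hirschLength_eq [Group.FG Q] (H : Subgroup Q) [Group.IsNilpotent H] [hH : H.FiniteIndex] :
    nilpotentHirschLength H = hirschLength Q := by
  have : {m | ∃ (K : Subgroup Q) (_ : Group.IsNilpotent K),
      K.FiniteIndex ∧ nilpotentHirschLength K = m} = {nilpotentHirschLength H} := by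
    ext m
    constructor
    · rintro ⟨K, hK, hK', rfl⟩
      exact nilpotentHirschLength_eq_of_finiteIndex K H
    · rintro rfl
      exact ⟨H, inferInstance, hH, rfl⟩
  rw [hirschLength, this, csInf_singleton]

end Commensurability

/-! ### Balls in the word metric. -/

section WordBall

variable {G : Type*} [Group G] {X : Set G}

theorem one_mem_wordBall (n : ℕ) : (1 : G) ∈ wordBall X n := ⟨[], by simp, by simp, rfl⟩

theorem mem_wordBall_one {x : G} (hx : x ∈ X) : x ∈ wordBall X 1 := ⟨[x], by simp, by simp [hx], by simp⟩

theorem wordBall_mono {m n : ℕ} (h : m ≤ n) : wordBall X m ⊆ wordBall X n := by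
  rintro _ ⟨l, hl, hl', rfl⟩
  exact ⟨l, hl.trans h, hl', rfl⟩

theorem mul_mem_wordBall {x y : G} {m n : ℕ} (hx : x ∈ wordBall X m) (hy : y ∈ wordBall X n) :
    x * y ∈ wordBall X (m + n) := by
  obtain ⟨l, hl, hl', rfl⟩ := hx
  obtain ⟨k, hk, hk', rfl⟩ := hy
  refine ⟨l ++ k, by simpa using add_le_add hl hk, fun y hy => ?_, List.prod_append⟩
  exact (List.mem_append.1 hy).elim (hl' y) (hk' y)

theorem inv_mem_wordBall {x : G} {n : ℕ} (hx : x ∈ wordBall X n) : x⁻¹ ∈ wordBall X n := by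
  obtain ⟨l, hl, hl', rfl⟩ := hx
  refine ⟨(l.map (·⁻¹)).reverse, by simpa using hl, fun y hy => ?_, (List.prod_inv_reverse l).symm⟩
  simp only [List.mem_reverse, List.mem_map] at hy
  obtain ⟨z, hz, rfl⟩ := hy
  rw [inv_inv]
  exact (hl' z hz).symm

theorem pow_mem_wordBall {x : G} {n : ℕ} (hx : x ∈ wordBall X n) (k : ℕ) :
    x ^ k ∈ wordBall X (n * k) := by
  induction k with
  | zero => simpa using one_mem_wordBall 0
  | succ k ih => rw [pow_succ, mul_add, mul_one]; exact mul_mem_wordBall ih hx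

theorem commutator_mem_wordBall {x y : G} {m n : ℕ} (hx : x ∈ wordBall X m)
    (hy : y ∈ wordBall X n) : ⁅x, y⁆ ∈ wordBall X (2 * (m + n)) := by
  refine wordBall_mono ?_ (mul_mem_wordBall (mul_mem_wordBall (mul_mem_wordBall hx hy)
    (inv_mem_wordBall hx)) (inv_mem_wordBall hy))
  omega

theorem wordBall_finite (hX : X.Finite) (n : ℕ) : (wordBall X n).Finite := by
  set Y : Set G := X ∪ X⁻¹
  have hY : Y.Finite := hX.union hX.inv
  have := hY.to_subtype
  refine ((List.finite_length_le Y n).image fun l => (l.map Subtype.val).prod).subset ?_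
  rintro _ ⟨l, hl, hl', rfl⟩
  refine ⟨l.attach.map fun y => ⟨y.1, (hl' y.1 y.2).imp id fun h => h⟩, by simpa using hl, ?_⟩
  simp [Function.comp_def]

end WordBall

/-! ### Lower bound for the growth of a nilpotent group, with constant `2 ^ D`. -/

section LowerGrowth

variable {G : Type*} [Group G]

/-- The word length of a left-normed commutator of weight `i + 1`. -/
def commLen : ℕ → ℕ
  | 0 => 1
  | i + 1 => 2 * commLen i + 2

/-- A coefficient `a` such that, modulo higher weight, powers of exponent less than `k ^ (i + 1)` of
a left-normed commutator of weight `i + 1` have representatives of length at most `a * k`. -/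
def powLen : ℕ → ℕ
  | 0 => 1
  | i + 1 => 2 * powLen i + 2 * commLen i + 2

theorem one_le_commLen (i : ℕ) : 1 ≤ commLen i := by
  cases i <;> simp [commLen]

theorem mem_wordBall_of_mem_leftComms {Y : Set G} {i : ℕ} {c : G} (hc : c ∈ leftComms Y i) :
    c ∈ wordBall Y (commLen i) := by
  induction i generalizing c with
  | zero => exact mem_wordBall_one hc
  | succ i ih =>
    obtain ⟨x, hx, y, hy, rfl⟩ := hc
    exact commutator_mem_wordBall (ih hx) (mem_wordBall_one hy)

/-- Write `m = k * q + r` with `r < k`. Bilinearity gives `⁅x, y⁆ ^ m ≡ ⁅x ^ q, y ^ k⁆ * ⁅x, y ^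
r⁆`, and `x ^ q` may be replaced by the short representative supplied by induction, as `q < k ^ (i +
1)`. -/
theorem exists_short_pow {Y : Set G} {k : ℕ} {i : ℕ} {c : G} (hc : c ∈ leftComms Y i)
    {m : ℕ} (hm : m < k ^ (i + 1)) :
    ∃ z ∈ wordBall Y (powLen i * k), z ∈ lcs G i ∧
      (z : G ⧸ lcs G (i + 1)) = (c : G ⧸ lcs G (i + 1)) ^ m := by
  induction i generalizing c m with
  | zero =>
    refine ⟨c ^ m, ?_, mem_top _, rfl⟩
    rw [zero_add, pow_one] at hm
    exact wordBall_mono (Nat.mul_le_mul_left _ hm.le) (pow_mem_wordBall (mem_wordBall_one hc) m)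
  | succ i ih =>
    obtain ⟨x, hx, y, hy, rfl⟩ := hc
    have hk : 0 < k := Nat.pos_of_ne_zero (by rintro rfl; simp at hm)
    have hxi := leftComms_subset Y i hx
    obtain ⟨z, hz, hz', e⟩ := ih hx (m := m / k) (Nat.div_lt_of_lt_mul (by rwa [← pow_succ']))
    have hy₁ : y ∈ wordBall Y 1 := mem_wordBall_one hy
    refine ⟨⁅z, y ^ k⁆ * ⁅x, y ^ (m % k)⁆, ?_, mul_mem (commutator_mem_lcs_succ hz' _)
      (commutator_mem_lcs_succ hxi _), ?_⟩
    · refine wordBall_mono ?_ (mul_mem_wordBall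
        (commutator_mem_wordBall hz (pow_mem_wordBall hy₁ k))
        (commutator_mem_wordBall (mem_wordBall_of_mem_leftComms hx) (pow_mem_wordBall hy₁ (m % k))))
      have h₁ := Nat.mod_lt m hk
      have h₂ := one_le_commLen i
      obtain ⟨k, rfl⟩ := Nat.exists_eq_succ_of_ne_zero hk.ne'
      have h₃ : k ≤ commLen i * k := Nat.le_mul_of_pos_left k h₂
      simp only [powLen, Nat.succ_eq_add_one] at *
      nlinarith
    · have hw : (x ^ (m / k))⁻¹ * z ∈ lcs G (i + 1) := by
        rw [← QuotientGroup.eq]; exact e.symm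
      have e₁ : ((⁅z, y⁆ : G) : G ⧸ lcs G (i + 2)) = (⁅x, y⁆ : G) ^ (m / k) := by
        rw [← mk_commutator_pow_left hxi, ← mul_inv_cancel_left (x ^ (m / k)) z,
          mk_commutator_mul_left (lcs_antitone (Nat.le_succ i) hw),
          (QuotientGroup.eq_one_iff _).2 (commutator_mem_lcs_succ hw y), mul_one]
      rw [QuotientGroup.mk_mul, mk_commutator_pow_right hz', e₁, mk_commutator_pow_right hxi,
        ← pow_mul, ← pow_add, mul_comm, Nat.div_add_mod]

theorem exists_short_prod {Y : Set G} {k i : ℕ} {ι : Type*} (v : ι → lcs G i)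
    (hv : ∀ j, (v j : G) ∈ leftComms Y i) (e : ι → ℕ) (he : ∀ j, e j < k ^ (i + 1))
    (J : Finset ι) : ∃ z : lcs G i, (z : G) ∈ wordBall Y (J.card * powLen i * k) ∧
      factorMk i z = ∏ j ∈ J, factorMk i (v j) ^ e j := by
  classical
  induction J using Finset.induction_on with
  | empty => exact ⟨1, one_mem_wordBall _, by simp⟩
  | insert a J ha ih =>
    obtain ⟨z, hz, h⟩ := ih
    obtain ⟨w, hw, hw', h'⟩ := exists_short_pow (hv a) (he a)
    refine ⟨⟨w, hw'⟩ * z, ?_, ?_⟩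
    · rw [Finset.card_insert_of_notMem ha]
      refine wordBall_mono (le_of_eq ?_) (mul_mem_wordBall hw hz)
      ring
    · rw [map_mul, h, Finset.prod_insert ha]
      congr 1
      rw [← map_pow, eq_comm, factorMk_eq_iff, ← QuotientGroup.eq]
      exact h'.symm

/-- Choose left-normed commutators that form a maximal independent family in the factor. Letting
each exponent range over `k ^ (i + 1)` values gives distinct classes, each with a short
representative. -/
theorem exists_finset_factor_injOn {Y : Set G} (hY : closure Y = ⊤) (hfin : Y.Finite) (k i : ℕ) :
    ∃ T : Finset G, (∀ t ∈ T, t ∈ lcs G i) ∧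
      (∀ t ∈ T, t ∈ wordBall Y (torsionFreeRank (LowerCentralFactor G i) * powLen i * k)) ∧
      T.card = k ^ ((i + 1) * torsionFreeRank (LowerCentralFactor G i)) ∧
      Set.InjOn (fun x : G => (x : G ⧸ lcs G (i + 1))) T := by
  classical
  have := (leftComms_finite hfin i).to_subtype
  let v : leftComms Y i → lcs G i := fun s => ⟨s, leftComms_subset Y i s.2⟩
  obtain ⟨I, hI, hcard, -⟩ := exists_linearIndepOn_ncard_eq_finrank
    (fun s => Additive.ofMul (factorMk i (v s))) (span_factor_eq_top hY subset_rfl _)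
  have : Fintype I := Fintype.ofFinite I
  have hcard' : Fintype.card I = torsionFreeRank (LowerCentralFactor G i) := by
    rw [← Nat.card_eq_fintype_card, Nat.card_coe_set_eq]; exact hcard
  choose f hf hf' using fun e : I → Fin (k ^ (i + 1)) =>
    exists_short_prod (Y := Y) (k := k) (i := i) (fun j : I => v j) (fun j => j.1.2)
      (fun j => (e j : ℕ)) (fun j => (e j).2) Finset.univ
  have hinj : ∀ e e', (f e : G ⧸ lcs G (i + 1)) = (f e' : G) → e = e' := by
    intro e e' h
    have h₁ : factorMk i (f e) = factorMk i (f e') := by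
      rw [factorMk_eq_iff, ← QuotientGroup.eq]; exact h
    rw [hf', hf'] at h₁
    have h₂ : ∑ j : I, ((e j : ℕ) : ℤ) • Additive.ofMul (factorMk i (v j)) =
        ∑ j : I, ((e' j : ℕ) : ℤ) • Additive.ofMul (factorMk i (v j)) := by
      simp only [natCast_zsmul]
      exact h₁
    rw [← sub_eq_zero, ← Finset.sum_sub_distrib] at h₂
    simp only [← sub_smul] at h₂
    have h₃ := Fintype.linearIndependent_iff.1 hI _ h₂
    ext j
    have := h₃ j
    omega
  refine ⟨Finset.univ.image fun e => (f e : G), ?_, ?_, ?_, ?_⟩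
  · intro t ht
    obtain ⟨e, -, rfl⟩ := Finset.mem_image.1 ht
    exact (f e).2
  · intro t ht
    obtain ⟨e, -, rfl⟩ := Finset.mem_image.1 ht
    rw [← hcard']
    exact hf e
  · rw [Finset.card_image_of_injective _ fun e e' h => hinj e e' (congrArg _ h)]
    simp [hcard', pow_mul]
  · intro x hx y hy h
    obtain ⟨e, -, rfl⟩ := Finset.mem_image.1 (Finset.mem_coe.1 hx)
    obtain ⟨e', -, rfl⟩ := Finset.mem_image.1 (Finset.mem_coe.1 hy)
    rw [hinj e e' h]

/-- Products `w * t` stay distinct: modulo `lcs G c` the factor `t` is invisible, which recovers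
`w`, and then `t` is recovered one level deeper. -/
theorem exists_finset_injOn {Y : Set G} (hY : closure Y = ⊤) (hfin : Y.Finite) (k c : ℕ) :
    ∃ W : Finset G, (∀ w ∈ W, w ∈ wordBall Y
        ((∑ i ∈ Finset.range c, torsionFreeRank (LowerCentralFactor G i) * powLen i) * k)) ∧
      W.card = k ^ (∑ i ∈ Finset.range c, (i + 1) * torsionFreeRank (LowerCentralFactor G i)) ∧
      Set.InjOn (fun x : G => (x : G ⧸ lcs G c)) W := by
  classical
  induction c with
  | zero => exact ⟨{1}, by simp [one_mem_wordBall], by simp, by simp⟩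
  | succ c ih =>
    obtain ⟨W, hW, hcard, hinj⟩ := ih
    obtain ⟨T, hT, hT', hTcard, hTinj⟩ := exists_finset_factor_injOn hY hfin k c
    have key : ∀ w ∈ W, ∀ t ∈ T, ∀ w' ∈ W, ∀ t' ∈ T,
        ((w * t : G) : G ⧸ lcs G (c + 1)) = (w' * t' : G) → w = w' ∧ t = t' := by
      intro w hw t ht w' hw' t' ht' h
      have h₁ : w = w' := by
        refine hinj hw hw' ?_
        rw [QuotientGroup.eq] at h
        have h₂ := mul_mem (mul_mem (hT t ht) (lcs_antitone (Nat.le_succ c) h))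
          (inv_mem (hT t' ht'))
        refine QuotientGroup.eq.2 ?_
        convert h₂ using 1
        group
      subst h₁
      refine ⟨rfl, hTinj ht ht' ?_⟩
      simpa using h
    refine ⟨(W ×ˢ T).image fun p => p.1 * p.2, ?_, ?_, ?_⟩
    · intro x hx
      obtain ⟨⟨w, t⟩, hp, rfl⟩ := Finset.mem_image.1 hx
      rw [Finset.mem_product] at hp
      rw [Finset.sum_range_succ, add_mul]
      exact mul_mem_wordBall (hW w hp.1) (hT' t hp.2)
    · rw [Finset.card_image_of_injOn, Finset.card_product, hcard, hTcard, ← pow_add,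
        Finset.sum_range_succ]
      rintro ⟨w, t⟩ hp ⟨w', t'⟩ hp' h
      rw [Finset.mem_coe, Finset.mem_product] at hp hp'
      obtain ⟨rfl, rfl⟩ := key w hp.1 t hp.2 w' hp'.1 t' hp'.2 (congrArg _ h)
      rfl
    · intro x hx y hy h
      obtain ⟨⟨w, t⟩, hp, rfl⟩ := Finset.mem_image.1 (Finset.mem_coe.1 hx)
      obtain ⟨⟨w', t'⟩, hp', rfl⟩ := Finset.mem_image.1 (Finset.mem_coe.1 hy)
      rw [Finset.mem_product] at hp hp'
      obtain ⟨rfl, rfl⟩ := key w hp.1 t hp.2 w' hp'.1 t' hp'.2 h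
      rfl

theorem pow_le_wordGrowth {Y : Set G} (hY : closure Y = ⊤) (hfin : Y.Finite) (k c : ℕ) :
    k ^ (∑ i ∈ Finset.range c, (i + 1) * torsionFreeRank (LowerCentralFactor G i)) ≤
      wordGrowth Y
        ((∑ i ∈ Finset.range c, torsionFreeRank (LowerCentralFactor G i) * powLen i) * k) := by
  obtain ⟨W, hW, hcard, -⟩ := exists_finset_injOn hY hfin k c
  rw [← hcard, ← Set.ncard_coe_finset]
  exact Set.ncard_le_ncard hW (wordBall_finite hfin _)

theorem commLen_le_powLen (i : ℕ) : commLen i ≤ powLen i := by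
  induction i with
  | zero => exact le_rfl
  | succ i ih => simp only [commLen, powLen]; omega

theorem powLen_le (c : ℕ) :
    powLen c ≤ 2 ^ (∑ i ∈ Finset.range c, (i + 1)) * (2 ^ (c + 1) - 1) := by
  -- The step uses `powLen (c + 2) ≤ 4 * powLen (c + 1)`. The analogous bound fails one place
  -- earlier, as `powLen 1 = 6` and `powLen 0 = 1`, so the induction starts at `1`.
  rcases c with - | c
  · simp [powLen]
  induction c with
  | zero => simp [powLen, commLen]
  | succ c ih =>
    have h₁ : powLen (c + 2) ≤ 4 * powLen (c + 1) := by
      have h₂ := commLen_le_powLen c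
      have h₃ := one_le_commLen c
      simp only [powLen, commLen]
      omega
    refine h₁.trans ((Nat.mul_le_mul_left 4 ih).trans ?_)
    rw [Finset.sum_range_succ _ (c + 1), Nat.pow_add 2 _ (c + 1 + 1), mul_left_comm, mul_assoc]
    refine Nat.mul_le_mul_left _ (Nat.mul_le_mul ?_
      (Nat.sub_le_sub_right (Nat.pow_le_pow_right two_pos (by omega)) 1))
    calc 4 = 2 ^ 2 := by norm_num
      _ ≤ _ := Nat.pow_le_pow_right two_pos (by omega)

theorem mul_two_pow_sub_one_le (r n : ℕ) : r * (2 ^ n - 1) + 1 ≤ 2 ^ (n * r) := by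
  induction r with
  | zero => simp
  | succ r ih =>
    rw [mul_add, pow_add, mul_one]
    obtain ⟨t, ht⟩ := Nat.exists_eq_succ_of_ne_zero (pow_pos (two_pos (α := ℕ)) n).ne'
    rw [ht] at ih ⊢
    simp only [Nat.succ_eq_add_one, Nat.add_sub_cancel] at *
    have h₁ : 1 ≤ 2 ^ (n * r) := Nat.one_le_two_pow
    nlinarith

/-- If `r c ≠ 0`, all earlier `r i` are positive, so the power of two in `powLen_le` is at most the
bound `E` already reached. The new term is then absorbed by the Bernoulli-type inequality `1 + r (2
^ (c + 1) - 1) ≤ 2 ^ ((c + 1) r)`. -/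
theorem sum_mul_powLen_le (r : ℕ → ℕ) (hr : ∀ i, r i = 0 → r (i + 1) = 0) (c : ℕ) :
    ∑ i ∈ Finset.range c, r i * powLen i ≤ 2 ^ ∑ i ∈ Finset.range c, (i + 1) * r i := by
  induction c with
  | zero => simp
  | succ c ih =>
    rw [Finset.sum_range_succ, Finset.sum_range_succ]
    rcases Nat.eq_zero_or_pos (r c) with h | h
    · simpa [h] using ih
    have hpos : ∀ i ≤ c, 0 < r i := by
      intro i hi
      by_contra h₀
      have : ∀ j, r (i + j) = 0 := fun j => by
        induction j with
        | zero => simpa using h₀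
        | succ j ihj => exact hr _ ihj
      have := this (c - i)
      rw [Nat.add_sub_cancel' hi] at this
      omega
    set E := 2 ^ ∑ i ∈ Finset.range c, (i + 1) * r i with hE
    have h₁ : 2 ^ (∑ i ∈ Finset.range c, (i + 1)) ≤ E := by
      refine Nat.pow_le_pow_right two_pos (Finset.sum_le_sum fun i hi => ?_)
      exact Nat.le_mul_of_pos_right _ (hpos i (Finset.mem_range.1 hi).le)
    have h₂ : r c * powLen c ≤ E * (r c * (2 ^ (c + 1) - 1)) := by
      calc r c * powLen c ≤ r c * (E * (2 ^ (c + 1) - 1)) :=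
            Nat.mul_le_mul_left _ ((powLen_le c).trans (Nat.mul_le_mul_right _ h₁))
        _ = _ := by ring
    calc _ ≤ E + E * (r c * (2 ^ (c + 1) - 1)) := add_le_add ih h₂
      _ = E * (r c * (2 ^ (c + 1) - 1) + 1) := by ring
      _ ≤ E * 2 ^ ((c + 1) * r c) := Nat.mul_le_mul_left _ (mul_two_pow_sub_one_le _ _)
      _ = _ := by rw [hE, ← pow_add]

theorem pow_le_wordGrowth_two_pow_mul [Group.FG G] {Y : Set G} (hY : closure Y = ⊤)
    (hfin : Y.Finite) (k c D : ℕ)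
    (hD : D = ∑ i ∈ Finset.range c, (i + 1) * torsionFreeRank (LowerCentralFactor G i)) :
    k ^ D ≤ wordGrowth Y (2 ^ D * k) := by
  subst hD
  refine (pow_le_wordGrowth hY hfin k c).trans
    (Set.ncard_le_ncard (wordBall_mono (Nat.mul_le_mul_right k ?_)) (wordBall_finite hfin _))
  exact sum_mul_powLen_le (fun i => torsionFreeRank (LowerCentralFactor G i))
    (fun i => torsionFreeRank_factor_succ_eq_zero) c

end LowerGrowth

/-! ### Collection of letters in weighted words. -/

section Words

variable {G : Type*} [Group G]

/-- The products of letters in which, for every `j`, at most `f j` letters are taken from `L j`. -/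
def wordsWith (L : ℕ → Set G) (f : ℕ → ℕ) : Set G :=
  {g | ∃ l : List (ℕ × G), (∀ p ∈ l, p.2 ∈ L p.1) ∧ (∀ j, l.countP (fun p => p.1 = j) ≤ f j) ∧
    (l.map Prod.snd).prod = g}

variable {L L' : ℕ → Set G} {f f' : ℕ → ℕ}

theorem one_mem_wordsWith : (1 : G) ∈ wordsWith L f := ⟨[], by simp, by simp, rfl⟩

theorem mem_wordsWith_single {j : ℕ} {x : G} (hx : x ∈ L j) : x ∈ wordsWith L (Pi.single j 1) := by
  refine ⟨[(j, x)], by simpa using hx, fun k => ?_, by simp⟩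
  by_cases h : j = k
  · subst h; simp
  · simp [h]

theorem mul_mem_wordsWith {x y : G} (hx : x ∈ wordsWith L f) (hy : y ∈ wordsWith L f') :
    x * y ∈ wordsWith L (f + f') := by
  obtain ⟨l, hl, hl', rfl⟩ := hx
  obtain ⟨k, hk, hk', rfl⟩ := hy
  refine ⟨l ++ k, fun p hp => ?_, fun j => ?_, by simp⟩
  · exact (List.mem_append.1 hp).elim (hl p) (hk p)
  · rw [List.countP_append]; exact add_le_add (hl' j) (hk' j)

theorem wordsWith_mono (hL : ∀ j, L j ⊆ L' j) (hf : f ≤ f') : wordsWith L f ⊆ wordsWith L' f' := by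
  rintro _ ⟨l, hl, hl', rfl⟩
  exact ⟨l, fun p hp => hL _ (hl p hp), fun j => (hl' j).trans (hf j), rfl⟩

theorem inv_mem_wordsWith (hL : ∀ j, ∀ x ∈ L j, x⁻¹ ∈ L j) {x : G} (hx : x ∈ wordsWith L f) :
    x⁻¹ ∈ wordsWith L f := by
  obtain ⟨l, hl, hl', rfl⟩ := hx
  refine ⟨(l.map fun p => (p.1, p.2⁻¹)).reverse, fun p hp => ?_, fun j => ?_, ?_⟩
  · simp only [List.mem_reverse, List.mem_map] at hp
    obtain ⟨q, hq, rfl⟩ := hp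
    exact hL _ _ (hl q hq)
  · rw [List.countP_reverse, List.countP_map]
    exact hl' j
  · rw [List.prod_inv_reverse, List.map_reverse, List.map_map, List.map_map]
    rfl

theorem pow_mem_wordsWith {x : G} (hx : x ∈ wordsWith L f) (n : ℕ) :
    x ^ n ∈ wordsWith L (n • f) := by
  induction n with
  | zero => simpa using one_mem_wordsWith
  | succ n ih => rw [pow_succ, succ_nsmul]; exact mul_mem_wordsWith ih hx

theorem zpow_mem_wordsWith (hL : ∀ j, ∀ x ∈ L j, x⁻¹ ∈ L j) {x : G} (hx : x ∈ wordsWith L f)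
    (n : ℤ) : x ^ n ∈ wordsWith L (n.natAbs • f) := by
  rcases Int.natAbs_eq n with h | h
  · rw [h, zpow_natCast, Int.natAbs_natCast]; exact pow_mem_wordsWith hx _
  · rw [h, zpow_neg, zpow_natCast, Int.natAbs_neg, Int.natAbs_natCast]
    exact inv_mem_wordsWith hL (pow_mem_wordsWith hx _)

theorem wordsWith_induction {P : (ℕ → ℕ) → G → Prop} (h_one : P 0 1)
    (h_mul : ∀ f g j, ∀ x ∈ L j, P f g → P (Pi.single j 1 + f) (x * g)) {g : G}
    (hg : g ∈ wordsWith L f) : ∃ f' ≤ f, P f' g := by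
  obtain ⟨l, hl, hl', rfl⟩ := hg
  suffices P (fun j => l.countP fun p => p.1 = j) (l.map Prod.snd).prod from ⟨_, hl', this⟩
  clear hl'
  induction l with
  | nil => exact h_one
  | cons p l ih =>
    have h := h_mul _ _ p.1 p.2 (hl p (by simp)) (ih fun q hq => hl q (by simp [hq]))
    convert h using 1
    · funext j
      rw [List.countP_cons, Pi.add_apply, add_comm]
      by_cases hj : p.1 = j
      · subst hj; simp
      · simp [hj]
    · simp

/-- Needed when a fixed word is raised to a power of order `n ^ (i + 1)`: letters of index below `i`
would violate the weight bound and must be absent. -/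
theorem exists_mem_wordsWith_vanishing {g : G} (hg : g ∈ wordsWith L f) :
    ∃ f', (∀ j, L j = ∅ → f' j = 0) ∧ g ∈ wordsWith L f' := by
  obtain ⟨l, hl, hl', rfl⟩ := hg
  refine ⟨fun j => l.countP fun p => p.1 = j, fun j hj => ?_, l, hl, fun _ => le_rfl, rfl⟩
  rw [List.countP_eq_zero]
  intro p hp h
  have := hl p hp
  rw [decide_eq_true_eq] at h
  rw [h, hj] at this
  exact this

/-- A bound for the number of letters after conjugating `e` times by a letter of weight `w`. -/
def conjBound (w e : ℕ) (f : ℕ → ℕ) (j : ℕ) : ℕ :=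
  ∑ k ∈ Finset.range (j + 1), (e + 1) ^ ((j - k) / w) * f k

theorem conjBound_add (w e : ℕ) (f f' : ℕ → ℕ) :
    conjBound w e (f + f') = conjBound w e f + conjBound w e f' := by
  funext j
  simp [conjBound, mul_add, Finset.sum_add_distrib]

theorem conjBound_mono {w e e' : ℕ} (he : e ≤ e') (hf : f ≤ f') :
    conjBound w e f ≤ conjBound w e' f' := fun _ =>
  Finset.sum_le_sum fun k _ => Nat.mul_le_mul (Nat.pow_le_pow_left (by omega) _) (hf k)

theorem le_conjBound (w e : ℕ) (f : ℕ → ℕ) : f ≤ conjBound w e f := fun j => by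
  refine le_trans ?_ (Finset.single_le_sum (fun _ _ => Nat.zero_le _)
    (Finset.mem_range.2 (Nat.lt_succ_self j)))
  simp

/-- One more conjugation adds a copy of the count shifted by `w`. The bound survives because `(e +
1) ^ (a + 1) + (e + 1) ^ a = (e + 1) ^ a * (e + 2)`. -/
theorem conjBound_succ {w : ℕ} (hw : 0 < w) (e : ℕ) (f : ℕ → ℕ) (j : ℕ) :
    conjBound w e f j + (if w ≤ j then conjBound w e f (j - w) else 0) ≤ conjBound w (e + 1) f j := by
  split_ifs with h
  · have hsub : Finset.range (j - w + 1) ⊆ Finset.range (j + 1) := Finset.range_mono (by omega)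
    simp only [conjBound]
    rw [← Finset.sum_sdiff hsub, ← Finset.sum_sdiff (f := fun k => (e + 1 + 1) ^ _ * f k) hsub,
      add_assoc, ← Finset.sum_add_distrib]
    refine add_le_add (Finset.sum_le_sum fun k _ =>
      Nat.mul_le_mul_right _ (Nat.pow_le_pow_left (by omega) _)) (Finset.sum_le_sum fun k hk => ?_)
    have hk' := Finset.mem_range.1 hk
    rw [← add_mul]
    refine Nat.mul_le_mul_right _ ?_
    have h₁ : (j - k) / w = (j - w - k) / w + 1 := by
      rw [show j - k = (j - w - k) + w by omega, Nat.add_div_right _ hw]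
    rw [h₁]
    set a := (j - w - k) / w
    calc (e + 1) ^ (a + 1) + (e + 1) ^ a = (e + 1) ^ a * (e + 1 + 1) := by ring
      _ ≤ (e + 1 + 1) ^ a * (e + 1 + 1) :=
        Nat.mul_le_mul_right _ (Nat.pow_le_pow_left (by omega) _)
      _ = _ := by ring
  · simpa using conjBound_mono (Nat.le_succ e) le_rfl j

/-- The shift of a sequence by `w` places. -/
def shiftBy (w : ℕ) (f : ℕ → ℕ) (j : ℕ) : ℕ := if w ≤ j then f (j - w) else 0

theorem shiftBy_mono {w : ℕ} (h : f ≤ f') : shiftBy w f ≤ shiftBy w f' := fun j => by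
  unfold shiftBy; split_ifs
  · exact h _
  · exact le_rfl

theorem shiftBy_single (w j : ℕ) : shiftBy w (Pi.single j 1) = Pi.single (j + w) 1 := by
  funext k
  unfold shiftBy
  split_ifs with h
  · by_cases hk : k = j + w
    · subst hk; simp
    · rw [Pi.single_eq_of_ne hk, Pi.single_eq_of_ne (by omega)]
  · rw [Pi.single_eq_of_ne (by omega)]

theorem shiftBy_add (w : ℕ) (f f' : ℕ → ℕ) :
    shiftBy w (f + f') = shiftBy w f + shiftBy w f' := by
  funext k
  simp only [shiftBy, Pi.add_apply]; split_ifs <;> rfl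

/-- Conjugation by `s` turns a letter of index `j` into itself times a letter of index `j + w`. -/
def ConjStable (L : ℕ → Set G) (w : ℕ) (s : G) : Prop :=
  ∀ j, ∀ x ∈ L j, s⁻¹ * x * s ∈ wordsWith L (Pi.single j 1 + Pi.single (j + w) 1)

theorem ConjStable.conj_mem {w : ℕ} {s : G} (hs : ConjStable L w s) {g : G}
    (hg : g ∈ wordsWith L f) : s⁻¹ * g * s ∈ wordsWith L (f + shiftBy w f) := by
  obtain ⟨f', hf', h⟩ : ∃ f' ≤ f, s⁻¹ * g * s ∈ wordsWith L (f' + shiftBy w f') := by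
    refine wordsWith_induction (P := fun f g => s⁻¹ * g * s ∈ wordsWith L (f + shiftBy w f))
      (by simpa using one_mem_wordsWith) (fun f g j x hx h => ?_) hg
    have h₁ := mul_mem_wordsWith (hs j x hx) h
    have e₁ : s⁻¹ * (x * g) * s = s⁻¹ * x * s * (s⁻¹ * g * s) := by group
    rw [shiftBy_add, shiftBy_single, e₁, add_add_add_comm]
    exact h₁
  exact wordsWith_mono (fun _ => subset_rfl) (add_le_add hf' (shiftBy_mono hf')) h

theorem ConjStable.conj_pow_mem {w : ℕ} (hw : 0 < w) {s : G} (hs : ConjStable L w s) {g : G}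
    (hg : g ∈ wordsWith L f) (e : ℕ) : (s ^ e)⁻¹ * g * s ^ e ∈ wordsWith L (conjBound w e f) := by
  induction e with
  | zero => simpa using wordsWith_mono (fun _ => subset_rfl) (le_conjBound w 0 f) hg
  | succ e ih =>
    have := hs.conj_mem ih
    have h := wordsWith_mono (f' := conjBound w (e + 1) f) (fun _ => subset_rfl)
      (conjBound_succ hw e f) this
    convert h using 1
    rw [pow_succ]; group

theorem ConjStable.conj_zpow_mem {w : ℕ} (hw : 0 < w) {s : G} (hs : ConjStable L w s)
    (hs' : ConjStable L w s⁻¹) {g : G} (hg : g ∈ wordsWith L f) (e : ℤ) :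
    (s ^ e)⁻¹ * g * s ^ e ∈ wordsWith L (conjBound w e.natAbs f) := by
  rcases Int.natAbs_eq e with h | h
  · rw [h, zpow_natCast, Int.natAbs_natCast]; exact hs.conj_pow_mem hw hg _
  · rw [h, zpow_neg, zpow_natCast, Int.natAbs_neg, Int.natAbs_natCast, ← inv_pow]
    exact hs'.conj_pow_mem hw hg _

/-- All occurrences of `s` are collected at the front, reading the word from its right end: a letter
`x` passes a collected power by `x * s ^ e = s ^ e * (s ^ (-e) * x * s ^ e)`. -/
theorem exists_zpow_mul_mem_wordsWith {w : ℕ} (hw : 0 < w) {s : G} (hs : ConjStable L' w s)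
    (hs' : ConjStable L' w s⁻¹) {i : ℕ}
    (hL : ∀ j, ∀ x ∈ L j, x ∈ L' j ∨ j = i ∧ (x = s ∨ x = s⁻¹)) {g : G} (hg : g ∈ wordsWith L f)
    {E : ℕ} (hE : f i ≤ E) :
    ∃ e : ℤ, e.natAbs ≤ f i ∧ (s ^ e)⁻¹ * g ∈ wordsWith L' (conjBound w E f) := by
  obtain ⟨f', hf', h⟩ : ∃ f' ≤ f, f' i ≤ E → ∃ e : ℤ, e.natAbs ≤ f' i ∧
      (s ^ e)⁻¹ * g ∈ wordsWith L' (conjBound w E f') := by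
    refine wordsWith_induction (P := fun f g => f i ≤ E → ∃ e : ℤ, e.natAbs ≤ f i ∧
      (s ^ e)⁻¹ * g ∈ wordsWith L' (conjBound w E f))
      (fun _ => ⟨0, by simp, by simpa using one_mem_wordsWith⟩) (fun f g j x hx h hE => ?_) hg
    have hfi : f i ≤ (Pi.single j 1 + f : ℕ → ℕ) i := Nat.le_add_left _ _
    obtain ⟨e, he, h'⟩ := h (hfi.trans hE)
    rcases hL j x hx with hx | ⟨rfl, hx⟩
    · refine ⟨e, he.trans hfi, ?_⟩
      have h₁ := hs.conj_zpow_mem hw hs' (mem_wordsWith_single hx) e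
      have h₂ := wordsWith_mono (fun _ => subset_rfl)
        (conjBound_mono (w := w) (he.trans (hfi.trans hE)) le_rfl) h₁
      have h₃ := mul_mem_wordsWith h₂ h'
      have e₁ : (s ^ e)⁻¹ * (x * g) = (s ^ e)⁻¹ * x * s ^ e * ((s ^ e)⁻¹ * g) := by group
      rw [conjBound_add, e₁]
      exact h₃
    · have h₃ := wordsWith_mono (L := L') (fun _ => subset_rfl)
        (conjBound_mono (w := w) (le_refl E)
        ((fun k => Nat.le_add_left _ _) : f ≤ Pi.single j 1 + f)) h'
      have hj : (Pi.single j 1 + f : ℕ → ℕ) j = f j + 1 := by simp [add_comm]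
      rw [hj]
      rcases hx with rfl | rfl
      · have e₁ : (x ^ (e + 1))⁻¹ * (x * g) = (x ^ e)⁻¹ * g := by rw [zpow_add_one]; group
        exact ⟨e + 1, (Int.natAbs_add_le e 1).trans (Nat.succ_le_succ he), by rw [e₁]; exact h₃⟩
      · have e₁ : (s ^ (e - 1))⁻¹ * (s⁻¹ * g) = (s ^ e)⁻¹ * g := by rw [zpow_sub_one]; group
        exact ⟨e - 1, (Int.natAbs_sub_le e 1).trans (Nat.succ_le_succ he), by rw [e₁]; exact h₃⟩
  obtain ⟨e, he, h⟩ := h ((hf' i).trans hE)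
  exact ⟨e, he.trans (hf' i), wordsWith_mono (fun _ => subset_rfl) (conjBound_mono le_rfl hf') h⟩

/-- Words in which the number of letters of weight `j + 1` is at most `K j * n ^ (j + 1)`. -/
def scaledWords (L : ℕ → Set G) (K : ℕ → ℕ) (n : ℕ) : Set G :=
  wordsWith L fun j => K j * n ^ (j + 1)

/-- Collection respects the scaling: a letter of index `k` turned into one of index `j` has passed
at most `q = (j - k) / (i + 1)` times, which costs `n ^ ((i + 1) * q) ≤ n ^ (j - k)`. -/
theorem conjBound_scaled (i : ℕ) (K : ℕ → ℕ) {n : ℕ} (hn : 1 ≤ n) :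
    conjBound (i + 1) (K i * n ^ (i + 1)) (fun j => K j * n ^ (j + 1)) ≤
      fun j => (∑ k ∈ Finset.range (j + 1), (K i + 1) ^ j * K k) * n ^ (j + 1) := by
  intro j
  simp only [conjBound]
  rw [Finset.sum_mul]
  refine Finset.sum_le_sum fun k hk => ?_
  have hk := Finset.mem_range.1 hk
  have h₁ : K i * n ^ (i + 1) + 1 ≤ (K i + 1) * n ^ (i + 1) := by
    have := Nat.one_le_pow (i + 1) n hn
    nlinarith
  set q := (j - k) / (i + 1) with hq
  have h₂ : (i + 1) * q ≤ j - k := Nat.mul_div_le _ _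
  have h₃ : q ≤ j := (Nat.div_le_self _ _).trans (Nat.sub_le _ _)
  calc _ ≤ ((K i + 1) * n ^ (i + 1)) ^ q * (K k * n ^ (k + 1)) :=
        Nat.mul_le_mul_right _ (Nat.pow_le_pow_left h₁ _)
    _ = (K i + 1) ^ q * K k * n ^ ((i + 1) * q + (k + 1)) := by
        rw [mul_pow, ← pow_mul, pow_add n ((i + 1) * q)]; ring
    _ ≤ (K i + 1) ^ j * K k * n ^ (j + 1) :=
        Nat.mul_le_mul (Nat.mul_le_mul_right _ (Nat.pow_le_pow_right (by omega) h₃))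
          (Nat.pow_le_pow_right hn (by omega))

/-- Scaled words in `L` are, up to left multiplication by one of `O(n ^ p)` elements, scaled words
in `L'`. -/
def Covers (L L' : ℕ → Set G) (p : ℕ) : Prop :=
  ∀ K : ℕ → ℕ, ∃ (K' : ℕ → ℕ) (C : ℕ), ∀ n : ℕ, 1 ≤ n → ∃ T : Finset G, T.card ≤ C * n ^ p ∧
    ∀ g ∈ scaledWords L K n, ∃ t ∈ T, t⁻¹ * g ∈ scaledWords L' K' n

theorem Covers.of_subset (h : ∀ j, L j ⊆ L' j) : Covers L L' 0 := fun K =>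
  ⟨K, 1, fun n _ => ⟨{1}, by simp, fun g hg => ⟨1, by simp, by
    rw [inv_one, one_mul]; exact wordsWith_mono h le_rfl hg⟩⟩⟩

theorem Covers.trans {L'' : ℕ → Set G} {p q : ℕ} (h : Covers L L' p) (h' : Covers L' L'' q) :
    Covers L L'' (p + q) := by
  classical
  intro K
  obtain ⟨K', C, h⟩ := h K
  obtain ⟨K'', C', h'⟩ := h' K'
  refine ⟨K'', C * C', fun n hn => ?_⟩
  obtain ⟨T, hT, h⟩ := h n hn
  obtain ⟨T', hT', h'⟩ := h' n hn
  refine ⟨(T ×ˢ T').image fun p => p.1 * p.2, ?_, fun g hg => ?_⟩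
  · refine Finset.card_image_le.trans ?_
    rw [Finset.card_product, pow_add, mul_mul_mul_comm]
    exact Nat.mul_le_mul hT hT'
  · obtain ⟨t, ht, h⟩ := h g hg
    obtain ⟨t', ht', h'⟩ := h' _ h
    refine ⟨t * t', Finset.mem_image.2 ⟨(t, t'), Finset.mem_product.2 ⟨ht, ht'⟩, rfl⟩, ?_⟩
    rwa [mul_inv_rev, mul_assoc]

theorem covers_of_free {s : G} {i : ℕ} (hs : ConjStable L' (i + 1) s)
    (hs' : ConjStable L' (i + 1) s⁻¹)
    (hL : ∀ j, ∀ x ∈ L j, x ∈ L' j ∨ j = i ∧ (x = s ∨ x = s⁻¹)) : Covers L L' (i + 1) := by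
  classical
  intro K
  refine ⟨fun j => ∑ k ∈ Finset.range (j + 1), (K i + 1) ^ j * K k, 2 * K i + 1,
    fun n hn => ⟨(Finset.Icc (-((K i * n ^ (i + 1) : ℕ) : ℤ))
    ((K i * n ^ (i + 1) : ℕ) : ℤ)).image fun e => s ^ e, ?_, fun g hg => ?_⟩⟩
  rotate_left
  · obtain ⟨e, he, h⟩ := exists_zpow_mul_mem_wordsWith (Nat.succ_pos i) hs hs' hL hg le_rfl
    refine ⟨s ^ e, Finset.mem_image.2 ⟨e, Finset.mem_Icc.2 (by omega), rfl⟩, ?_⟩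
    exact wordsWith_mono (fun _ => subset_rfl) (conjBound_scaled i K hn) h
  · refine Finset.card_image_le.trans ?_
    rw [Int.card_Icc]
    have := Nat.one_le_pow (i + 1) n hn
    have h₂ : (2 * K i + 1) * n ^ (i + 1) = 2 * (K i * n ^ (i + 1)) + n ^ (i + 1) := by ring
    omega

/-- The collected exponent is reduced modulo `m`, leaving at most `m` coset representatives. The
remaining power of `s ^ m` is rewritten in `L'` with `O(n ^ (i + 1))` letters of each index, allowed
since only indices at least `i` occur. -/
theorem covers_of_torsion {s : G} {i : ℕ} (hs : ConjStable L' (i + 1) s)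
    (hs' : ConjStable L' (i + 1) s⁻¹)
    (hL : ∀ j, ∀ x ∈ L j, x ∈ L' j ∨ j = i ∧ (x = s ∨ x = s⁻¹))
    (hinv : ∀ j, ∀ x ∈ L' j, x⁻¹ ∈ L' j) (hlow : ∀ j < i, L' j = ∅) {m : ℕ} (hm : 0 < m)
    (hsm : ∃ F, s ^ m ∈ wordsWith L' F) : Covers L L' 0 := by
  classical
  obtain ⟨F, hF⟩ := hsm
  obtain ⟨F, hF₀, hF⟩ := exists_mem_wordsWith_vanishing hF
  intro K
  refine ⟨fun j => K i * F j + ∑ k ∈ Finset.range (j + 1), (K i + 1) ^ j * K k, m, fun n hn =>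
    ⟨(Finset.range m).image fun e => s ^ e, ?_, fun g hg => ?_⟩⟩
  · simpa using Finset.card_image_le (s := Finset.range m) (f := fun e => s ^ e)
  · obtain ⟨e, he, h⟩ := exists_zpow_mul_mem_wordsWith (Nat.succ_pos i) hs hs' hL hg le_rfl
    have h₁ := wordsWith_mono (fun _ => subset_rfl) (conjBound_scaled i K hn) h
    have hm' : (m : ℤ) ≠ 0 := by exact_mod_cast hm.ne'
    have hr := Int.emod_nonneg e hm'
    have hr' := Int.emod_lt_of_pos e (by exact_mod_cast hm : (0 : ℤ) < m)
    refine ⟨s ^ (e % m).toNat, Finset.mem_image.2 ⟨_, Finset.mem_range.2 (by omega), rfl⟩, ?_⟩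
    have h₂ := mul_mem_wordsWith (zpow_mem_wordsWith hinv hF (e / m)) h₁
    have hq : (e / m).natAbs ≤ K i * n ^ (i + 1) := by
      have := Int.abs_ediv_le_abs e m
      rw [Int.abs_eq_natAbs, Int.abs_eq_natAbs] at this
      exact (Int.ofNat_le.1 this).trans he
    have e₁ : (s ^ (e % m).toNat)⁻¹ * g = (s ^ m) ^ (e / m) * ((s ^ e)⁻¹ * g) := by
      rw [← zpow_natCast, Int.toNat_of_nonneg hr, ← zpow_natCast, ← zpow_mul, ← mul_assoc,
        ← zpow_neg, ← zpow_neg, ← zpow_add]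
      congr 2
      have := Int.mul_ediv_add_emod e m
      linarith
    rw [e₁]
    refine wordsWith_mono (fun _ => subset_rfl) (fun j => ?_) h₂
    simp only [Pi.add_apply, Pi.smul_apply, smul_eq_mul]
    rw [add_mul]
    refine add_le_add ?_ le_rfl
    rcases lt_or_ge j i with hj | hj
    · simp [hF₀ j (hlow j hj)]
    · calc _ ≤ K i * n ^ (i + 1) * F j := Nat.mul_le_mul_right _ hq
          _ = K i * F j * n ^ (i + 1) := by ring
          _ ≤ _ := Nat.mul_le_mul_left _ (Nat.pow_le_pow_right hn (by omega))

end Words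

/-! ### Upper bound for the growth of a nilpotent group. -/

section UpperGrowth

variable {G : Type*} [Group G]

/-- The iterated commutators of weight `i + 1` (in any bracketing) of elements of `Y ∪ Y⁻¹`. -/
inductive IsLetter (Y : Set G) : ℕ → G → Prop
  | gen {y : G} (hy : y ∈ Y) : IsLetter Y 0 y
  | gen_inv {y : G} (hy : y ∈ Y) : IsLetter Y 0 y⁻¹
  | comm {i j : ℕ} {x y : G} (hx : IsLetter Y i x) (hy : IsLetter Y j y) :
      IsLetter Y (i + j + 1) ⁅x, y⁆

variable {Y : Set G}

theorem IsLetter.inv {i : ℕ} {x : G} (hx : IsLetter Y i x) : IsLetter Y i x⁻¹ := by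
  cases hx with
  | gen hy => exact .gen_inv hy
  | gen_inv hy => rw [inv_inv]; exact .gen hy
  | comm hx hy =>
    rw [commutatorElement_inv]
    convert IsLetter.comm hy hx using 1
    ring

theorem IsLetter.mem_lcs {i : ℕ} {x : G} (hx : IsLetter Y i x) : x ∈ lcs G i := by
  induction hx with
  | gen _ => exact mem_top _
  | gen_inv _ => exact mem_top _
  | comm _ _ hx hy => exact commutator_mem_lcs hx hy

theorem isLetter_of_mem_leftComms {i : ℕ} {x : G} (hx : x ∈ leftComms Y i) : IsLetter Y i x := by
  induction i generalizing x with
  | zero => exact .gen hx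
  | succ i ih =>
    obtain ⟨x, hx, y, hy, rfl⟩ := hx
    exact .comm (ih hx) (.gen hy)

theorem finite_isLetter (hY : Y.Finite) (i : ℕ) : {x | IsLetter Y i x}.Finite := by
  induction i using Nat.strong_induction_on with
  | _ i ih =>
    have h : (⋃ a ∈ Finset.range i, ⋃ b ∈ Finset.range i,
        Set.image2 (fun x y : G => ⁅x, y⁆) {x | IsLetter Y a x} {x | IsLetter Y b x}).Finite := by
      refine (Finset.range i).finite_toSet.biUnion fun a ha =>
        (Finset.range i).finite_toSet.biUnion fun b hb => (ih a ?_).image2 _ (ih b ?_)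
      · simpa using ha
      · simpa using hb
    refine ((hY.union hY.inv).union h).subset fun x hx => ?_
    cases hx with
    | gen hy => exact Or.inl (Or.inl hy)
    | gen_inv hy => exact Or.inl (Or.inr (by simpa using hy))
    | @comm a b x y hx hy =>
      refine Or.inr ?_
      simp only [Set.mem_iUnion, Finset.mem_range]
      exact ⟨a, by omega, b, by omega, x, hx, y, hy, rfl⟩

/-- The letters of index greater than `i`, together with the elements of `l` and their inverses as
letters of index `i`. -/
def letterFamily (Y : Set G) (i : ℕ) (l : List G) (j : ℕ) : Set G :=
  {x | i < j ∧ IsLetter Y j x ∨ j = i ∧ (x ∈ l ∨ x⁻¹ ∈ l)}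

variable {i : ℕ} {l : List G}

theorem isLetter_of_mem_letterFamily (hl : ∀ s ∈ l, IsLetter Y i s) {j : ℕ} {x : G}
    (hx : x ∈ letterFamily Y i l j) : IsLetter Y j x := by
  rcases hx with ⟨-, hx⟩ | ⟨rfl, hx | hx⟩
  · exact hx
  · exact hl x hx
  · simpa using (hl _ hx).inv

theorem inv_mem_letterFamily {j : ℕ} {x : G} (hx : x ∈ letterFamily Y i l j) :
    x⁻¹ ∈ letterFamily Y i l j := by
  rcases hx with ⟨h, hx⟩ | ⟨h, hx⟩
  · exact Or.inl ⟨h, hx.inv⟩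
  · exact Or.inr ⟨h, by rw [inv_inv]; exact hx.symm⟩

theorem letterFamily_eq_empty {j : ℕ} (hj : j < i) : letterFamily Y i l j = ∅ := by
  rw [Set.eq_empty_iff_forall_notMem]
  rintro x (⟨h, -⟩ | ⟨h, -⟩) <;> omega

/-- The identity is `s⁻¹ * x * s = x * ⁅x⁻¹, s⁻¹⁆`. An index is a weight minus one, hence the shift
by `i + 1`. -/
theorem conjStable_letterFamily (hl : ∀ s ∈ l, IsLetter Y i s) {s : G} (hs : IsLetter Y i s) :
    ConjStable (letterFamily Y i l) (i + 1) s := by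
  intro j x hx
  have h : ⁅x⁻¹, s⁻¹⁆ ∈ letterFamily Y i l (j + (i + 1)) :=
    Or.inl ⟨by omega, .comm (isLetter_of_mem_letterFamily hl hx).inv hs.inv⟩
  have := mul_mem_wordsWith (mem_wordsWith_single hx) (mem_wordsWith_single h)
  convert this using 1
  rw [commutatorElement_def]; group

theorem mem_letterFamily_cons {s : G} {j : ℕ} {x : G} (hx : x ∈ letterFamily Y i (s :: l) j) :
    x ∈ letterFamily Y i l j ∨ j = i ∧ (x = s ∨ x = s⁻¹) := by
  rcases hx with hx | ⟨rfl, hx | hx⟩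
  · exact Or.inl (Or.inl hx)
  · rcases List.mem_cons.1 hx with rfl | hx
    · exact Or.inr ⟨rfl, Or.inl rfl⟩
    · exact Or.inl (Or.inr ⟨rfl, Or.inl hx⟩)
  · rcases List.mem_cons.1 hx with h | hx
    · exact Or.inr ⟨rfl, Or.inr (by rw [← h, inv_inv])⟩
    · exact Or.inl (Or.inr ⟨rfl, Or.inr hx⟩)

theorem letterFamily_mono {l' : List G} (h : l ⊆ l') (j : ℕ) :
    letterFamily Y i l j ⊆ letterFamily Y i l' j := by
  rintro x (hx | ⟨rfl, hx⟩)
  · exact Or.inl hx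
  · exact Or.inr ⟨rfl, hx.imp (@h x) (@h _)⟩

theorem covers_free_list (hl : ∀ s ∈ l, IsLetter Y i s) :
    Covers (letterFamily Y i l) (letterFamily Y i []) ((i + 1) * l.length) := by
  induction l with
  | nil => exact Covers.of_subset fun _ => subset_rfl
  | cons s l ih =>
    have hl' : ∀ s ∈ l, IsLetter Y i s := fun t ht => hl t (List.mem_cons_of_mem _ ht)
    have hs := hl s (by simp)
    have := (covers_of_free (conjStable_letterFamily hl' hs) (conjStable_letterFamily hl' hs.inv)
      fun j x => mem_letterFamily_cons).trans (ih hl')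
    convert this using 1
    rw [List.length_cons]; ring

/-- The elements that are words in the letters of `L`. -/
def wordSubgroup (L : ℕ → Set G) (hL : ∀ j, ∀ x ∈ L j, x⁻¹ ∈ L j) : Subgroup G where
  carrier := {g | ∃ f, g ∈ wordsWith L f}
  one_mem' := ⟨0, one_mem_wordsWith⟩
  mul_mem' := fun ⟨_, hx⟩ ⟨_, hy⟩ => ⟨_, mul_mem_wordsWith hx hy⟩
  inv_mem' := fun ⟨_, hx⟩ => ⟨_, inv_mem_wordsWith hL hx⟩

theorem mem_wordSubgroup {L : ℕ → Set G} {hL : ∀ j, ∀ x ∈ L j, x⁻¹ ∈ L j} {j : ℕ} {x : G}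
    (hx : x ∈ L j) : x ∈ wordSubgroup L hL := ⟨_, mem_wordsWith_single hx⟩

theorem covers_torsion_list {l' : List G} (hl : ∀ s ∈ l', IsLetter Y i s)
    (ht : ∀ s ∈ l, IsLetter Y i s ∧ ∃ m : ℕ, 0 < m ∧
      s ^ m ∈ wordSubgroup (letterFamily Y i l') fun _ _ => inv_mem_letterFamily) :
    Covers (letterFamily Y i (l ++ l')) (letterFamily Y i l') 0 := by
  induction l with
  | nil => exact Covers.of_subset fun _ => subset_rfl
  | cons s l ih =>
    have hl₁ : ∀ s ∈ l ++ l', IsLetter Y i s := fun t h => (List.mem_append.1 h).elim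
      (fun h => (ht t (List.mem_cons_of_mem _ h)).1) (hl t)
    obtain ⟨hs, m, hm, f, hf⟩ := ht s (by simp)
    exact (covers_of_torsion (conjStable_letterFamily hl₁ hs) (conjStable_letterFamily hl₁ hs.inv)
      (fun j x => mem_letterFamily_cons) (fun _ _ => inv_mem_letterFamily)
      (fun _ => letterFamily_eq_empty) hm
      ⟨f, wordsWith_mono (letterFamily_mono (List.subset_append_right _ _)) le_rfl hf⟩).trans
      (ih fun t h => ht t (List.mem_cons_of_mem _ h))

/-- Downward induction from a trivial term, where nilpotency enters: each term is generated modulo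
the next by left-normed commutators, which are letters of index above `i`. -/
theorem lcs_le_wordSubgroup [Group.IsNilpotent G] (hY : closure Y = ⊤) (i : ℕ) :
    lcs G (i + 1) ≤ wordSubgroup (letterFamily Y i l) fun _ _ => inv_mem_letterFamily := by
  obtain ⟨c, hc⟩ := Subgroup.nilpotent_iff_lowerCentralSeries.1
    (inferInstance : Group.IsNilpotent G)
  have key : ∀ k, i < k → lcs G k ≤
      wordSubgroup (letterFamily Y i l) fun _ _ => inv_mem_letterFamily := by
    intro k hk
    by_cases hck : c ≤ k
    · exact (lcs_antitone hck).trans (hc.le.trans bot_le)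
    refine Nat.decreasingInduction' (P := fun k => i < k → lcs G k ≤
      wordSubgroup (letterFamily Y i l) fun _ _ => inv_mem_letterFamily) ?_ (not_le.1 hck).le
      (fun _ => hc.le.trans bot_le) hk
    intro k _ _ ih hk
    refine (lcs_le_closure_leftComms_sup hY k).trans (sup_le ?_ (ih (by omega)))
    rw [closure_le]
    exact fun x hx => mem_wordSubgroup (Or.inl ⟨hk, isLetter_of_mem_leftComms hx⟩)
  exact key (i + 1) (Nat.lt_succ_self i)

theorem exists_word_factorMk_eq {y : Additive (LowerCentralFactor G i)}
    (hy : y ∈ Submodule.span ℤ {z | ∃ (s : G) (h : s ∈ lcs G i), s ∈ l ∧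
      z = Additive.ofMul (factorMk i ⟨s, h⟩)}) :
    ∃ w : lcs G i, (w : G) ∈ wordSubgroup (letterFamily Y i l) (fun _ _ => inv_mem_letterFamily) ∧
      Additive.ofMul (factorMk i w) = y := by
  induction hy using Submodule.span_induction with
  | mem x hx =>
    obtain ⟨s, hs, h, rfl⟩ := hx
    exact ⟨⟨s, hs⟩, mem_wordSubgroup (j := i) (Or.inr ⟨rfl, Or.inl h⟩), rfl⟩
  | zero => exact ⟨1, one_mem _, by rw [map_one]; rfl⟩
  | add x y _ _ hx hy =>
    obtain ⟨w, hw, rfl⟩ := hx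
    obtain ⟨w', hw', rfl⟩ := hy
    exact ⟨w * w', mul_mem hw hw', by rw [map_mul]; rfl⟩
  | smul a x _ hx =>
    obtain ⟨w, hw, rfl⟩ := hx
    exact ⟨w ^ a, zpow_mem hw a, by rw [map_zpow]; rfl⟩

/-- Among the letters of index `i` a maximal independent family is kept aside. Every letter has a
power that is a word in these and in higher letters, so collecting the others costs only a constant.
Each of the `torsionFreeRank` independent letters then costs `n ^ (i + 1)`. -/
theorem covers_lcs [Group.IsNilpotent G] (hY : closure Y = ⊤) (hfin : Y.Finite) (i : ℕ) :
    Covers (fun j => {x | i ≤ j ∧ IsLetter Y j x}) (fun j => {x | i + 1 ≤ j ∧ IsLetter Y j x})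
      ((i + 1) * torsionFreeRank (LowerCentralFactor G i)) := by
  classical
  have hS := finite_isLetter hfin i
  set S := {x | IsLetter Y i x} with hSdef
  have := hS.to_subtype
  have hS' : S ⊆ lcs G i := fun x hx => IsLetter.mem_lcs hx
  obtain ⟨I, hI, hcard, htors⟩ := exists_linearIndepOn_ncard_eq_finrank
    (fun s : S => Additive.ofMul (factorMk i ⟨(s : G), hS' s.2⟩))
    (span_factor_eq_top hY (fun x => isLetter_of_mem_leftComms) hS')
  set free : List G := (Set.toFinite I).toFinset.toList.map Subtype.val with hfree
  set tors : List G := hS.toFinset.toList with htorsdef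
  have hfreemem : ∀ s : S, s ∈ I → (s : G) ∈ free := fun s hs => by
    rw [hfree, List.mem_map]; exact ⟨s, by simpa using hs, rfl⟩
  have hfreeS : ∀ s ∈ free, IsLetter Y i s := fun s hs => by
    rw [hfree, List.mem_map] at hs
    obtain ⟨s, -, rfl⟩ := hs
    exact s.2
  have htorsmem : ∀ s, s ∈ tors ↔ IsLetter Y i s := fun s => by simp [htorsdef, hSdef]
  have hlen : free.length = torsionFreeRank (LowerCentralFactor G i) := by
    rw [hfree, List.length_map, Finset.length_toList, ← Set.ncard_eq_toFinset_card]
    exact hcard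
  have h₀ : Covers (fun j => {x | i ≤ j ∧ IsLetter Y j x})
      (letterFamily Y i (tors ++ free)) 0 := by
    refine Covers.of_subset fun j x ⟨hj, hx⟩ => ?_
    rcases hj.lt_or_eq with h | rfl
    · exact Or.inl ⟨h, hx⟩
    · exact Or.inr ⟨rfl, Or.inl (List.mem_append_left _ ((htorsmem x).2 hx))⟩
  have h₁ : Covers (letterFamily Y i (tors ++ free)) (letterFamily Y i free) 0 := by
    refine covers_torsion_list hfreeS fun s hs => ?_
    have hs := (htorsmem s).1 hs
    obtain ⟨a, ha, h⟩ := htors ⟨s, hs⟩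
    obtain ⟨w, hw, hw'⟩ := exists_word_factorMk_eq (Submodule.span_mono (by
      rintro _ ⟨t, ht, rfl⟩
      exact ⟨t, hS' t.2, hfreemem t ht, rfl⟩) h)
    refine ⟨hs, a, ha, ?_⟩
    have h₂ : factorMk i w = factorMk i (⟨s, hS' hs⟩ ^ a) := by
      rw [map_pow]; exact hw'
    rw [factorMk_eq_iff] at h₂
    have := mul_mem hw (lcs_le_wordSubgroup hY i h₂)
    rwa [mul_inv_cancel_left] at this
  have h₂ := covers_free_list hfreeS
  have h₃ : Covers (letterFamily Y i []) (fun j => {x | i + 1 ≤ j ∧ IsLetter Y j x}) 0 := by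
    refine Covers.of_subset fun j x hx => ?_
    rcases hx with ⟨h, hx⟩ | ⟨-, h | h⟩
    · exact ⟨h, hx⟩
    · simp at h
    · simp at h
  have := ((h₀.trans h₁).trans h₂).trans h₃
  rw [hlen] at this
  simpa using this

theorem covers_sum [Group.IsNilpotent G] (hY : closure Y = ⊤) (hfin : Y.Finite) (c : ℕ) :
    Covers (fun j => {x | 0 ≤ j ∧ IsLetter Y j x}) (fun j => {x | c ≤ j ∧ IsLetter Y j x})
      (∑ i ∈ Finset.range c, (i + 1) * torsionFreeRank (LowerCentralFactor G i)) := by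
  induction c with
  | zero => exact Covers.of_subset fun _ => subset_rfl
  | succ c ih =>
    rw [Finset.sum_range_succ]
    exact ih.trans (covers_lcs hY hfin c)

theorem exists_wordGrowth_le [Group.IsNilpotent G] (hY : closure Y = ⊤) (hfin : Y.Finite) {c : ℕ}
    (hc : lcs G c = ⊥) : ∃ C : ℕ, ∀ n : ℕ, 1 ≤ n → wordGrowth Y n ≤
      C * n ^ (∑ i ∈ Finset.range c, (i + 1) * torsionFreeRank (LowerCentralFactor G i)) := by
  -- A word of length at most `n` in the generators uses at most `n` letters of index `0`, so all
  -- constants may be taken equal to `1`. After `c` stages the remainder lies in `lcs G c = ⊥`, so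
  -- the ball is contained in `T`.
  obtain ⟨K', C, h⟩ := covers_sum hY hfin c fun _ => 1
  refine ⟨C, fun n hn => ?_⟩
  obtain ⟨T, hT, h⟩ := h n hn
  refine le_trans ?_ hT
  rw [wordGrowth, ← Set.ncard_coe_finset]
  refine Set.ncard_le_ncard (fun g hg => ?_) T.finite_toSet
  obtain ⟨t, ht, l, hl, -, h⟩ := h g (by
    obtain ⟨l, hl, hl', rfl⟩ := hg
    refine ⟨l.map fun y => (0, y), fun p hp => ?_, fun j => ?_, by simp [Function.comp_def]⟩
    · obtain ⟨y, hy, rfl⟩ := List.mem_map.1 hp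
      refine ⟨le_rfl, ?_⟩
      rcases hl' y hy with h | h
      · exact .gen h
      · simpa using IsLetter.gen_inv h
    · refine List.countP_le_length.trans ?_
      simp only [List.length_map, one_mul, pow_succ]
      exact hl.trans (Nat.le_mul_of_pos_left n (pow_pos hn j)))
  have h₁ : t⁻¹ * g ∈ lcs G c := by
    rw [← h]
    refine list_prod_mem fun x hx => ?_
    obtain ⟨p, hp, rfl⟩ := List.mem_map.1 hx
    obtain ⟨hj, hp⟩ := hl p hp
    exact lcs_antitone hj hp.mem_lcs
  rw [hc, mem_bot, inv_mul_eq_one] at h₁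
  rwa [← h₁]

end UpperGrowth

/-! ### Finiteness of lower central terms under central extensions. -/

section FiniteByNilpotent

theorem finite_setOf_pow_eq_one (A : Type*) [CommGroup A] [Group.FG A] :
    {x : A | ∃ n : ℕ, 0 < n ∧ x ^ n = 1}.Finite := by
  have : Module.Finite ℤ (Additive A) :=
    Module.Finite.iff_addGroup_fg.2 (GroupFG.iff_add_fg.1 inferInstance)
  have : Finite (Submodule.torsion ℤ (Additive A)) :=
    Module.finite_of_fg_torsion _ (Submodule.torsion_isTorsion)
  refine (Set.toFinite (Submodule.torsion ℤ (Additive A) : Set (Additive A))).subset ?_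
  rintro x ⟨n, hn, h⟩
  exact ⟨⟨(n : ℤ), by simpa using hn.ne'⟩, by
    rw [Submonoid.mk_smul, natCast_zsmul]; exact h⟩

variable {F : Type*} [Group F]

theorem fg_of_le_of_commutative {A B : Subgroup F} (hA : A.FG)
    (hc : ∀ x ∈ A, ∀ y ∈ A, x * y = y * x)
    (hBA : B ≤ A) : B.FG := by
  let _ : CommGroup A := { (inferInstance : Group A) with
    mul_comm := fun x y => Subtype.ext (hc x x.2 y y.2) }
  have : Group.FG A := (Group.fg_iff_subgroup_fg A).2 hA
  have : Module.Finite ℤ (Additive A) :=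
    Module.Finite.iff_addGroup_fg.2 (GroupFG.iff_add_fg.1 inferInstance)
  have h : (B.subgroupOf A).FG := by
    rw [Subgroup.fg_iff_add_fg]
    have h := IsNoetherian.noetherian (AddSubgroup.toIntSubmodule (B.subgroupOf A).toAddSubgroup)
    rw [Submodule.fg_iff_addSubgroup_fg] at h
    exact h
  obtain ⟨S, hS, hfin⟩ := (Subgroup.fg_iff _).1 h
  refine (Subgroup.fg_iff _).2 ⟨A.subtype '' S, ?_, hfin.image _⟩
  rw [← MonoidHom.map_closure, hS, map_subgroupOf_eq_of_le hBA]

theorem fg_of_finiteIndex_of_fg (N : Subgroup F) [N.FiniteIndex] (hN : N.FG) : Group.FG F := by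
  obtain ⟨S, hS, hfin⟩ := (Subgroup.fg_iff _).1 hN
  have := finite_quotient_of_finiteIndex (H := N)
  refine Group.fg_iff.2 ⟨S ∪ Set.range (fun q : F ⧸ N => q.out), ?_, hfin.union (Set.finite_range _)⟩
  rw [eq_top_iff]
  intro x _
  set r : F := (x : F ⧸ N).out with hr
  have h : r⁻¹ * x ∈ closure S := hS ▸ QuotientGroup.eq.1 (QuotientGroup.out_eq' (x : F ⧸ N))
  have e : r * (r⁻¹ * x) = x := by group
  rw [← e]
  exact mul_mem (subset_closure (Or.inr ⟨(x : F ⧸ N), rfl⟩)) (closure_mono Set.subset_union_left h)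

/-- A commutator depends only on the cosets of its entries modulo a central subgroup. This is the
hypothesis of Schur's theorem on finite commutator subgroups. -/
theorem finite_commutatorSet_of_finiteIndex {N : Subgroup F} [N.FiniteIndex] (hN : N ≤ center F) :
    Finite (commutatorSet F) := by
  have := finite_quotient_of_finiteIndex (H := N)
  refine Set.Finite.to_subtype (((Set.finite_range fun p : (F ⧸ N) × (F ⧸ N) =>
    ⁅p.1.out, p.2.out⁆)).subset ?_)
  rintro _ ⟨x, y, rfl⟩
  refine ⟨((x : F ⧸ N), (y : F ⧸ N)), ?_⟩
  have key : ∀ x : F, ∃ z ∈ center F, (x : F ⧸ N).out = x * z := fun x => by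
    refine ⟨x⁻¹ * (x : F ⧸ N).out, hN (QuotientGroup.eq.1 (QuotientGroup.out_eq' (x : F ⧸ N)).symm),
      by group⟩
  obtain ⟨z, hz, hx⟩ := key x
  obtain ⟨w, hw, hy⟩ := key y
  simp only [hx, hy]
  have hz := mem_center_iff.1 hz
  have hw := mem_center_iff.1 hw
  have h₁ : ⁅x * z, y * w⁆ = ⁅x, y * w⁆ := by
    rw [commutatorElement_mul_left_eq_conj_mul]
    have : ⁅z, y * w⁆ = 1 := commutatorElement_eq_one_iff_mul_comm.2 (hz _).symm
    rw [this]; simp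
  rw [h₁, commutatorElement_mul_right_eq_mul_conj]
  have : ⁅x, w⁆ = 1 := commutatorElement_eq_one_iff_mul_comm.2 (hw _)
  rw [this]; simp

theorem finite_lcs_of_finite_ker {F' : Type*} [Group F'] (π : F →* F')
    (hker : Finite π.ker) {k : ℕ} (h : Finite (lcs F' k)) : Finite (lcs F k) := by
  refine (MonoidHom.finite_iff_finite_ker_range (lcsMap π k)).2 ⟨?_, inferInstance⟩
  refine Finite.of_injective (fun x : (lcsMap π k).ker => (⟨(x : lcs F k), ?_⟩ : π.ker)) ?_
  · exact congrArg Subtype.val x.2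
  · intro x y hxy
    have h : ((x : lcs F k) : F) = (y : lcs F k) := congrArg (fun z : π.ker => (z : F)) hxy
    exact Subtype.ext (Subtype.ext h)

/-- `M = lcs F k` is central-by-finite, so its commutator subgroup is finite by Schur, and being
finitely generated it has only finitely many elements that are torsion in its abelianization. All
`⁅x, y⁆` with `x ∈ M` are such: a power of `x` is central in `F`, so `x` and its conjugate agree up
to torsion there. -/
theorem finite_lcs_succ_of_central {F' : Type*} [Group F'] (π : F →* F')
    (hcent : π.ker ≤ center F) (hfg : π.ker.FG) {k : ℕ} (h : Finite (lcs F' k)) :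
    Finite (lcs F (k + 1)) := by
  set M := lcs F k with hM
  have hcomm : ∀ x ∈ π.ker, ∀ y ∈ π.ker, x * y = y * x := fun x _ y hy =>
    mem_center_iff.1 (hcent hy) x
  set Z : Subgroup M := (lcsMap π k).ker with hZ
  have hZmem : ∀ x : M, x ∈ Z → (x : F) ∈ π.ker := fun x hx => congrArg Subtype.val hx
  have : Z.FiniteIndex := finiteIndex_ker _
  have hZc : Z ≤ center M := fun x hx => mem_center_iff.2 fun y =>
    Subtype.ext (mem_center_iff.1 (hcent (hZmem x hx)) y)
  have hZfg : Z.FG := by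
    have h := fg_of_le_of_commutative hfg hcomm (B := Z.map M.subtype) (by
      rintro _ ⟨x, hx, rfl⟩; exact hZmem x hx)
    rw [← Group.fg_iff_subgroup_fg] at h ⊢
    exact Group.fg_of_surjective (f := (Z.equivMapOfInjective M.subtype
      M.subtype_injective).symm.toMonoidHom) (MulEquiv.surjective _)
  have : Group.FG M := fg_of_finiteIndex_of_fg Z hZfg
  have := finite_commutatorSet_of_finiteIndex hZc
  have hK : (_root_.commutator M : Set M).Finite :=
    (inferInstance : Finite (_root_.commutator M))
  have hfg' : Group.FG (Abelianization M) := Group.fg_of_surjective (f := Abelianization.of)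
    (QuotientGroup.mk'_surjective _)
  have hfinM : {x : M | ∃ n : ℕ, 0 < n ∧ Abelianization.of x ^ n = 1}.Finite := by
    have h₁ := finite_setOf_pow_eq_one (Abelianization M)
    refine Set.Finite.preimage' (f := fun x : M => Abelianization.of x) h₁ fun b _ => ?_
    obtain ⟨y, rfl⟩ := QuotientGroup.mk_surjective b
    refine (hK.image fun z => y * z).subset fun x hx => ?_
    exact ⟨y⁻¹ * x, QuotientGroup.eq.1 (Eq.symm hx), by group⟩
  let T : Subgroup M :=
    { carrier := {x : M | ∃ n : ℕ, 0 < n ∧ Abelianization.of x ^ n = 1}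
      one_mem' := ⟨1, one_pos, by simp⟩
      mul_mem' := by
        rintro x y ⟨n, hn, hx⟩ ⟨m, hm, hy⟩
        exact ⟨n * m, Nat.mul_pos hn hm, by
          rw [map_mul, mul_pow, pow_mul, hx, mul_comm n, pow_mul, hy, one_pow, one_pow, one_mul]⟩
      inv_mem' := by
        rintro x ⟨n, hn, hx⟩
        exact ⟨n, hn, by rw [map_inv, inv_pow, hx, inv_one]⟩ }
  have hT : lcs F (k + 1) ≤ T.map M.subtype := by
    refine commutator_le.2 fun x hx y _ => ?_
    set y' : MulAut M := MulAut.conjNormal y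
    set x' : M := ⟨x, hx⟩
    refine ⟨x' * (y' x')⁻¹, ⟨Z.index.factorial, Nat.factorial_pos _, ?_⟩, ?_⟩
    · have hx'Z : x' ^ Z.index.factorial ∈ Z :=
        Z.pow_mem_of_index_ne_zero_of_dvd FiniteIndex.index_ne_zero x'
          fun m h₀ hm => Nat.dvd_factorial h₀ hm
      have hfix : y' (x' ^ Z.index.factorial) = x' ^ Z.index.factorial := by
        ext
        rw [MulAut.conjNormal_apply, mem_center_iff.1 (hcent (hZmem _ hx'Z)) y, mul_inv_cancel_right]
      rw [map_mul, map_inv, mul_pow, inv_pow, ← map_pow, ← map_pow, ← map_pow y', hfix,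
        mul_inv_cancel]
    · change x * (y * x * y⁻¹)⁻¹ = ⁅x, y⁆
      rw [commutatorElement_def]; group
  have : Finite T := hfinM.to_subtype
  have : (T.map M.subtype : Set F).Finite := (Set.toFinite (T : Set M)).image _
  exact (this.subset hT).to_subtype

end FiniteByNilpotent

/-! ### Actions trivial modulo torsion, and finite-by-nilpotent groups. -/

section FiniteByNilpotent

theorem factorMap_mk_pow_eq_iff {H : Type*} [Group H] (φ : H →* H) {i : ℕ} (x : lcs H i) (n : ℕ) :
    factorMap φ i (factorMk i x) ^ n = factorMk i x ^ n ↔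
      (φ (x : H) ^ n)⁻¹ * (x : H) ^ n ∈ lcs H (i + 1) := by
  rw [factorMap_mk, ← map_pow, ← map_pow (factorMk i) x, factorMk_eq_iff, coe_pow, coe_pow]
  rfl

/-- By bilinearity, if `φ` fixes `u ^ n` and `v ^ m` modulo the next terms, it fixes `⁅u, v⁆ ^ (n *
m)` modulo its next term. -/
theorem exists_factorMap_pow_eq {H : Type*} [Group H] (φ : H →* H)
    (h₀ : ∀ z : LowerCentralFactor H 0, ∃ n : ℕ, 0 < n ∧ factorMap φ 0 z ^ n = z ^ n) (i : ℕ)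
    (z : LowerCentralFactor H i) : ∃ n : ℕ, 0 < n ∧ factorMap φ i z ^ n = z ^ n := by
  induction i with
  | zero => exact h₀ z
  | succ i ih =>
    let T : Subgroup (LowerCentralFactor H (i + 1)) :=
      { carrier := {z | ∃ n : ℕ, 0 < n ∧ factorMap φ (i + 1) z ^ n = z ^ n}
        one_mem' := ⟨1, one_pos, by simp⟩
        mul_mem' := by
          rintro x y ⟨n, hn, hx⟩ ⟨m, hm, hy⟩
          refine ⟨n * m, Nat.mul_pos hn hm, ?_⟩
          rw [map_mul, mul_pow, mul_pow, pow_mul, hx, mul_comm n, pow_mul _ m n, hy,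
            ← pow_mul, ← pow_mul, mul_comm m]
        inv_mem' := by
          rintro x ⟨n, hn, hx⟩
          exact ⟨n, hn, by rw [map_inv, inv_pow, hx, inv_pow]⟩ }
    have key : lcs H (i + 1) ≤ (T.comap (factorMk (i + 1))).map (lcs H (i + 1)).subtype := by
      refine commutator_le.2 fun u hu v _ => ⟨⟨⁅u, v⁆, commutator_mem_lcs_succ hu v⟩, ?_, rfl⟩
      obtain ⟨n, hn, hun⟩ := ih (factorMk i ⟨u, hu⟩)
      obtain ⟨m, hm, hvm⟩ := h₀ (factorMk 0 ⟨v, mem_top v⟩)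
      rw [factorMap_mk_pow_eq_iff] at hun hvm
      refine ⟨n * m, Nat.mul_pos hn hm, ?_⟩
      rw [factorMap_mk_pow_eq_iff]
      change (φ ⁅u, v⁆ ^ (n * m))⁻¹ * ⁅u, v⁆ ^ (n * m) ∈ lcs H (i + 2)
      rw [← QuotientGroup.eq, QuotientGroup.mk_pow, QuotientGroup.mk_pow, map_commutatorElement,
        pow_mul, pow_mul]
      have hφu : φ u ∈ lcs H i := map_mem_lcs φ hu
      rw [← mk_commutator_pow_left hφu, ← mk_commutator_pow_right (pow_mem hφu n),
        ← mk_commutator_pow_left hu, ← mk_commutator_pow_right (pow_mem hu n)]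
      have eu : u ^ n = φ u ^ n * ((φ u ^ n)⁻¹ * u ^ n) := by group
      have ev : v ^ m = φ v ^ m * ((φ v ^ m)⁻¹ * v ^ m) := by group
      rw [eu, ev, mk_commutator_mul_left (lcs_antitone i.le_succ hun),
        mk_commutator_mul_right (pow_mem hφu n),
        (QuotientGroup.eq_one_iff _).2 (commutator_mem_lcs_succ hun _),
        (QuotientGroup.eq_one_iff _).2 (commutator_mem_lcs (pow_mem hφu n) hvm), mul_one, mul_one]
    obtain ⟨x, rfl⟩ := factorMk_surjective _ z
    obtain ⟨y, hy, hyx⟩ := key x.2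
    rw [← (Subtype.ext hyx : y = x)]
    exact hy

variable {F : Type*} [Group F]

theorem coe_mem_lowerCentralSeries_iff {H : Subgroup F} (x : H) (i : ℕ) :
    (x : F) ∈ H.lowerCentralSeries i ↔ x ∈ lcs H i := by
  rw [← top_subtype_lowerCentralSeries]
  exact ⟨fun ⟨y, hy, hyx⟩ => (Subtype.ext hyx : y = x) ▸ hy, fun hx => ⟨x, hx, rfl⟩⟩

theorem exists_pow_conj_eq_of_lowerCentralSeries_eq_bot {H : Subgroup F} [H.Normal] {c : ℕ}
    (hc : H.lowerCentralSeries (c + 1) = ⊥) (f : F)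
    (hf : ∀ h ∈ H, ∃ n : ℕ, 0 < n ∧ ((f * h * f⁻¹) ^ n)⁻¹ * h ^ n ∈ H.lowerCentralSeries 1)
    {a : F} (haH : a ∈ H) (ha : a ∈ H.lowerCentralSeries c) :
    ∃ n : ℕ, 0 < n ∧ (f * a * f⁻¹) ^ n = a ^ n := by
  let φ : H →* H := (MulAut.conjNormal f : MulAut H).toMonoidHom
  have hφ : ∀ x : H, (φ x : F) = f * x * f⁻¹ := fun x => MulAut.conjNormal_apply f x
  have h := exists_factorMap_pow_eq φ (fun z => by
    obtain ⟨x, rfl⟩ := factorMk_surjective _ z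
    obtain ⟨n, hn, h⟩ := hf _ (x : H).2
    refine ⟨n, hn, ?_⟩
    rw [factorMap_mk_pow_eq_iff, ← coe_mem_lowerCentralSeries_iff]
    exact h) c (factorMk c ⟨⟨a, haH⟩, (coe_mem_lowerCentralSeries_iff ⟨a, haH⟩ c).1 ha⟩)
  obtain ⟨n, hn, h⟩ := h
  refine ⟨n, hn, ?_⟩
  rw [factorMap_mk_pow_eq_iff, ← coe_mem_lowerCentralSeries_iff, hc,
    mem_bot] at h
  exact inv_mul_eq_one.1 h

theorem fg_lowerCentralSeries_of_succ_eq_bot {H : Subgroup F} (hH : H.FG) {c : ℕ}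
    (hc : H.lowerCentralSeries (c + 1) = ⊥) : (H.lowerCentralSeries c).FG := by
  obtain ⟨Y, hY, hfin⟩ := Group.fg_iff.1 ((Group.fg_iff_subgroup_fg H).2 hH)
  have hc' : lcs H (c + 1) = ⊥ := by
    rw [← top_subtype_lowerCentralSeries] at hc
    exact (map_eq_bot_iff_of_injective _ H.subtype_injective).1 hc
  have h₁ := lcs_le_closure_leftComms_sup hY c
  rw [hc', sup_bot_eq] at h₁
  have h₂ : closure (leftComms Y c) = lcs H c := le_antisymm
    ((closure_le _).2 (leftComms_subset Y c)) h₁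
  refine (Subgroup.fg_iff _).2 ⟨H.subtype '' leftComms Y c, ?_, (leftComms_finite hfin c).image _⟩
  rw [← MonoidHom.map_closure, h₂, top_subtype_lowerCentralSeries]

/-- Induction on the class of `H`. Let `A` be the last term of its lower central series and `D = ⁅A,
F⁆`. Since `F` acts on `A` trivially up to torsion, `D` lies in the torsion of a finitely generated
abelian group and is finite. Induction handles `F ⧸ A`. The extension `F ⧸ D → F ⧸ A` is central
with finitely generated kernel, and `F → F ⧸ D` has finite kernel, so finiteness lifts through both.
-/
theorem exists_finite_lcs.{u} (c : ℕ) : ∀ (F : Type u) [Group F] (H : Subgroup F) [H.Normal]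
    [H.FiniteIndex], H.FG → H.lowerCentralSeries c = ⊥ →
    (∀ f, ∀ h ∈ H, ∃ n : ℕ, 0 < n ∧ ((f * h * f⁻¹) ^ n)⁻¹ * h ^ n ∈ H.lowerCentralSeries 1) →
    ∃ k, Finite (lcs F k) := by
  induction c with
  | zero =>
    intro F _ H _ _ _ hc _
    have hH : H = ⊥ := hc
    have : Finite F := by
      have := ‹H.FiniteIndex›
      rw [hH] at this
      exact Nat.finite_of_card_ne_zero (by rw [← index_bot]; exact this.index_ne_zero)
    exact ⟨0, inferInstance⟩
  | succ c ih =>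
    intro F _ H _ _ hfg hc htor
    set A := H.lowerCentralSeries c with hA
    have hAn : A.Normal := inferInstance
    have hAH : A ≤ H := lowerCentralSeries_le_self H c
    have hcommAH : ∀ a ∈ A, ∀ h ∈ H, a * h = h * a := fun a ha h hh => by
      have h₁ : ⁅a, h⁆ ∈ H.lowerCentralSeries (c + 1) := commutator_mem_commutator ha hh
      rw [hc, mem_bot] at h₁
      exact commutatorElement_eq_one_iff_mul_comm.1 h₁
    have hAcomm : ∀ a ∈ A, ∀ b ∈ A, a * b = b * a := fun a ha b hb => hcommAH a ha b (hAH hb)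
    have hAfg : A.FG := fg_lowerCentralSeries_of_succ_eq_bot hfg hc
    set D := ⁅A, (⊤ : Subgroup F)⁆ with hD
    have hDA : D ≤ A := commutator_le_left A ⊤
    have hDfin : Finite D := by
      let _ : CommGroup A := { (inferInstance : Group A) with
        mul_comm := fun x y => Subtype.ext (hAcomm x x.2 y y.2) }
      have : Group.FG A := (Group.fg_iff_subgroup_fg A).2 hAfg
      have hfin := finite_setOf_pow_eq_one A
      let T : Subgroup A :=
        { carrier := {x : A | ∃ n : ℕ, 0 < n ∧ x ^ n = 1}
          one_mem' := ⟨1, one_pos, by simp⟩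
          mul_mem' := by
            rintro x y ⟨n, hn, hx⟩ ⟨m, hm, hy⟩
            exact ⟨n * m, Nat.mul_pos hn hm, by
              rw [mul_pow, pow_mul, hx, mul_comm n, pow_mul, hy, one_pow, one_pow, one_mul]⟩
          inv_mem' := by
            rintro x ⟨n, hn, hx⟩
            exact ⟨n, hn, by rw [inv_pow, hx, inv_one]⟩ }
      have hDT : D ≤ T.map A.subtype := by
        refine commutator_le.2 fun a ha f _ => ?_
        obtain ⟨n, hn, h⟩ := exists_pow_conj_eq_of_lowerCentralSeries_eq_bot hc f (htor f)
          (hAH ha) ha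
        let b : A := ⟨f * a * f⁻¹, hAn.conj_mem a ha f⟩
        refine ⟨⟨a, ha⟩ * b⁻¹, ⟨n, hn, ?_⟩, ?_⟩
        · have hb : b ^ n = ⟨a, ha⟩ ^ n := Subtype.ext h
          rw [mul_pow, inv_pow, hb, mul_inv_cancel]
        · change a * (f * a * f⁻¹)⁻¹ = ⁅a, f⁆
          rw [commutatorElement_def]; group
      have : (T.map A.subtype : Set F).Finite := Set.Finite.image _ hfin
      exact (this.subset hDT).to_subtype
    have : (H.map (QuotientGroup.mk' A)).FiniteIndex :=
      finiteIndex_iff.2 (ne_zero_of_dvd_ne_zero FiniteIndex.index_ne_zero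
        (H.index_map_dvd (QuotientGroup.mk'_surjective A)))
    have : (H.map (QuotientGroup.mk' A)).Normal := Normal.map ‹_› _ (QuotientGroup.mk'_surjective A)
    obtain ⟨k, hk⟩ := ih (F ⧸ A) (H.map (QuotientGroup.mk' A)) (by
        rw [← Group.fg_iff_subgroup_fg] at hfg ⊢
        exact Group.fg_of_surjective (f := (QuotientGroup.mk' A).subgroupMap H)
          (MonoidHom.subgroupMap_surjective _ _)) (by
        rw [← map_lowerCentralSeries, Subgroup.map_eq_bot_iff, QuotientGroup.ker_mk']) (by
        intro f
        obtain ⟨f, rfl⟩ := QuotientGroup.mk'_surjective A f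
        rintro _ ⟨h, hh, rfl⟩
        obtain ⟨n, hn, h₁⟩ := htor f h hh
        refine ⟨n, hn, ?_⟩
        rw [← map_lowerCentralSeries]
        refine ⟨_, h₁, ?_⟩
        simp only [map_mul, map_inv, map_pow])
    let π : F ⧸ D →* F ⧸ A := QuotientGroup.map D A (MonoidHom.id F) hDA
    have hπ : π.ker = A.map (QuotientGroup.mk' D) := by
      ext x
      obtain ⟨x, rfl⟩ := QuotientGroup.mk'_surjective D x
      constructor
      · exact fun hx => ⟨x, (QuotientGroup.eq_one_iff x).1 hx, rfl⟩
      · rintro ⟨y, hy, hyx⟩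
        rw [← hyx]
        exact (QuotientGroup.eq_one_iff y).2 hy
    have h₁ : Finite (lcs (F ⧸ D) (k + 1)) := by
      refine finite_lcs_succ_of_central π ?_ ?_ hk
      · rw [hπ]
        rintro _ ⟨a, ha, rfl⟩
        refine mem_center_iff.2 fun f => ?_
        obtain ⟨f, rfl⟩ := QuotientGroup.mk'_surjective D f
        rw [eq_comm, ← commutatorElement_eq_one_iff_mul_comm, ← map_commutatorElement]
        exact (QuotientGroup.eq_one_iff _).2 (commutator_mem_commutator ha (mem_top f))
      · rw [hπ]
        rw [← Group.fg_iff_subgroup_fg] at hAfg ⊢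
        exact Group.fg_of_surjective (f := (QuotientGroup.mk' D).subgroupMap A)
          (MonoidHom.subgroupMap_surjective _ _)
    exact ⟨k + 1, finite_lcs_of_finite_ker (QuotientGroup.mk' D)
      (by rw [QuotientGroup.ker_mk']; exact hDfin) h₁⟩

end FiniteByNilpotent

/-! ### The integral representation on the abelianization and its kernel. -/

section LinearAction

variable {G : Type*} [Group G]

theorem mem_torsion_int_iff {M : Type*} [AddCommGroup M] (x : M) :
    x ∈ Submodule.torsion ℤ M ↔ ∃ n : ℕ, 0 < n ∧ n • x = 0 := by
  constructor
  · rintro ⟨a, ha⟩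
    refine ⟨(a : ℤ).natAbs, Int.natAbs_pos.2 (nonZeroDivisors.ne_zero a.2), ?_⟩
    rw [Submonoid.smul_def] at ha
    rcases Int.natAbs_eq (a : ℤ) with h | h
    · rw [h, natCast_zsmul] at ha; exact ha
    · rw [h, neg_smul, neg_eq_zero, natCast_zsmul] at ha; exact ha
  · rintro ⟨n, hn, h⟩
    exact ⟨⟨(n : ℤ), by simpa using hn.ne'⟩, by rw [Submonoid.mk_smul, natCast_zsmul]; exact h⟩

/-- The action is read on the quotient of `A` by its torsion, which is free of rank `torsionFreeRank
A`; being trivial there means fixing some power of each element. -/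
theorem exists_hom_GL_of_action {A : Type*} [CommGroup A] [Module.Finite ℤ (Additive A)]
    (ρ : G →* Monoid.End A) :
    ∃ Φ : G →* Matrix.GeneralLinearGroup (Fin (torsionFreeRank A)) ℤ,
      ∀ g, Φ g = 1 ↔ ∀ a : A, ∃ n : ℕ, 0 < n ∧ (ρ g a) ^ n = a ^ n := by
  let M := Additive A
  let T := Submodule.torsion ℤ M
  let σ : G →* Module.End ℤ M :=
    (addMonoidEndRingEquivInt M : AddMonoid.End M →* Module.End ℤ M).comp
      ((MulEquiv.Monoid.End : Monoid.End A ≃* AddMonoid.End M).toMonoidHom.comp ρ)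
  have hT : ∀ f : Module.End ℤ M, T ≤ T.comap f := fun f x hx => by
    obtain ⟨n, hn, h⟩ := (mem_torsion_int_iff x).1 hx
    exact (mem_torsion_int_iff _).2 ⟨n, hn, by rw [← map_nsmul, h, map_zero]⟩
  let τ : Module.End ℤ M →* Module.End ℤ (M ⧸ T) :=
    { toFun := fun f => T.mapQ T f (hT f)
      map_one' := T.mapQ_id
      map_mul' := fun f g => T.mapQ_comp T T g f (hT g) (hT f) }
  have : Module.Free ℤ (M ⧸ T) := Module.free_of_finite_type_torsion_free'
  have hr : Module.finrank ℤ (M ⧸ T) = torsionFreeRank A := finrank_quotient_eq_of_le_torsion le_rfl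
  let b := Module.finBasisOfFinrankEq ℤ (M ⧸ T) hr
  let Ψ : G →* Matrix (Fin (torsionFreeRank A)) (Fin (torsionFreeRank A)) ℤ :=
    (LinearMap.toMatrixAlgEquiv b : _ →* _).comp (τ.comp σ)
  refine ⟨Ψ.toHomUnits, fun g => ?_⟩
  have h₁ : Ψ.toHomUnits g = 1 ↔ τ (σ g) = 1 := by
    rw [Units.ext_iff, MonoidHom.coe_toHomUnits, Units.val_one]
    exact map_eq_one_iff (LinearMap.toMatrixAlgEquiv b) (LinearMap.toMatrixAlgEquiv b).injective
  rw [h₁]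
  have h₂ : ∀ a : A, (τ (σ g)) (Submodule.Quotient.mk (Additive.ofMul a)) =
      Submodule.Quotient.mk (Additive.ofMul a) ↔ ∃ n : ℕ, 0 < n ∧ (ρ g a) ^ n = a ^ n := by
    intro a
    change (Submodule.Quotient.mk (Additive.ofMul (ρ g a)) : M ⧸ T) = _ ↔ _
    rw [Submodule.Quotient.eq, mem_torsion_int_iff]
    refine exists_congr fun n => and_congr_right fun _ => ?_
    rw [smul_sub, sub_eq_zero]
    exact Iff.rfl
  refine ⟨fun h a => (h₂ a).1 (by rw [h]; rfl), fun h => LinearMap.ext fun x => ?_⟩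
  obtain ⟨a, rfl⟩ := Submodule.Quotient.mk_surjective _ x
  exact (h₂ a).2 (h a)

/-- `K` is the kernel of the representation on the abelianization of `H` modulo torsion. It contains
`H` because inner automorphisms act trivially there, so the image is finite, and its order is the
index of `K`. -/
theorem exists_subgroup_finite_lcs [Group.FG G] (H : Subgroup G) [H.Normal] [H.FiniteIndex]
    [Group.IsNilpotent H] :
    ∃ K : Subgroup G, H ≤ K ∧
      K.index ∈ finiteSubgroupOrdersGL (torsionFreeRank (LowerCentralFactor H 0)) ∧
      ∃ k, Finite (lcs K k) := by
  have : Group.FG H := fg_of_index_ne_zero H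
  have := finite_additive_factor (G := H) 0
  let φ : G → H →* H := fun g => (MulAut.conjNormal g : MulAut H).toMonoidHom
  let ρ : G →* Monoid.End (LowerCentralFactor H 0) :=
    { toFun := fun g => factorMap (φ g) 0
      map_one' := by
        have : φ 1 = MonoidHom.id H := by ext; simp [φ]
        rw [this]; exact factorMap_id 0
      map_mul' := fun g g' => by
        have : φ (g * g') = (φ g).comp (φ g') := by ext; simp [φ]
        rw [this]; exact factorMap_comp _ _ 0 }
  have hρ : ∀ g (h : H) (n : ℕ), ρ g (factorMk 0 ⟨h, mem_top h⟩) ^ n = factorMk 0 ⟨h, mem_top h⟩ ^ n ↔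
      ((g * h * g⁻¹) ^ n)⁻¹ * (h : G) ^ n ∈ H.lowerCentralSeries 1 := fun g h n =>
    (factorMap_mk_pow_eq_iff (φ g) _ n).trans (coe_mem_lowerCentralSeries_iff _ 1).symm
  obtain ⟨Φ, hΦ⟩ := exists_hom_GL_of_action ρ
  have hHK : H ≤ Φ.ker := fun g hg => by
    refine (hΦ g).2 fun z => ⟨1, one_pos, ?_⟩
    obtain ⟨h, rfl⟩ := factorMk_surjective _ z
    refine (hρ g h 1).2 ?_
    have : ((g * h * g⁻¹) ^ 1)⁻¹ * (h : G) ^ 1 = ⁅g, ((h : H) : G)⁻¹⁆ := by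
      rw [commutatorElement_def]; group
    rw [this]
    exact commutator_mem_commutator hg (inv_mem (h : H).2)
  have : Φ.ker.FiniteIndex := finiteIndex_of_le hHK
  refine ⟨Φ.ker, hHK, ⟨Φ.range, ?_, (index_ker Φ).symm⟩, ?_⟩
  · exact Nat.finite_of_card_ne_zero (by rw [← index_ker]; exact FiniteIndex.index_ne_zero)
  set K := Φ.ker with hK
  have hmap : ∀ i, ((H.subgroupOf K).lowerCentralSeries i).map K.subtype =
      H.lowerCentralSeries i := fun i => by
    rw [map_lowerCentralSeries, map_subgroupOf_eq_of_le hHK]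
  obtain ⟨c, hc⟩ := Subgroup.nilpotent_iff_lowerCentralSeries.1 (inferInstance : Group.IsNilpotent H)
  refine exists_finite_lcs c K (H.subgroupOf K) ?_ ?_ ?_
  · rw [← Group.fg_iff_subgroup_fg]
    exact Group.fg_of_surjective (f := (subgroupOfEquivOfLe hHK).symm.toMonoidHom)
      (MulEquiv.surjective _)
  · refine (map_eq_bot_iff_of_injective _ K.subtype_injective).1 ?_
    rw [hmap, ← top_subtype_lowerCentralSeries, hc, Subgroup.map_bot]
  · intro f h hh
    obtain ⟨n, hn, e⟩ := (hΦ f).1 f.2 (factorMk 0 ⟨⟨h, hh⟩, mem_top _⟩)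
    refine ⟨n, hn, ?_⟩
    rw [← mem_map_iff_mem K.subtype_injective, hmap]
    exact (hρ f ⟨h, hh⟩ n).1 e

/-- The map `H → K ⧸ lcs K k` has kernel inside the finite `lcs K k` and image of finite index. -/
theorem torsionFreeRank_factor_quotient_lcs_eq [Group.FG G] {H K : Subgroup G} (hHK : H ≤ K)
    [H.FiniteIndex] {k : ℕ} (hk : Finite (lcs K k)) (i : ℕ) :
    torsionFreeRank (LowerCentralFactor H i) =
      torsionFreeRank (LowerCentralFactor (K ⧸ lcs K k) i) := by
  have : K.FiniteIndex := finiteIndex_of_le hHK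
  have : Group.FG K := fg_of_index_ne_zero K
  have : Group.IsNilpotent (K ⧸ lcs K k) := by
    refine Subgroup.nilpotent_iff_lowerCentralSeries.2 ⟨k, ?_⟩
    have h := map_lowerCentralSeries (⊤ : Subgroup K) (QuotientGroup.mk' (lcs K k)) k
    rw [← MonoidHom.range_eq_map, MonoidHom.range_eq_top.2 (QuotientGroup.mk'_surjective _)] at h
    rw [← h, Subgroup.map_eq_bot_iff, QuotientGroup.ker_mk']
  let φ : H →* K ⧸ lcs K k := (QuotientGroup.mk' (lcs K k)).comp (inclusion hHK)
  have : Finite φ.ker := by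
    refine Finite.of_injective (fun x : φ.ker => (⟨inclusion hHK x, ?_⟩ : lcs K k)) ?_
    · exact (QuotientGroup.eq_one_iff _).1 x.2
    · intro x y hxy
      have h : inclusion hHK x = inclusion hHK y := congrArg (fun z : lcs K k => (z : K)) hxy
      exact Subtype.ext (inclusion_injective hHK h)
  have : φ.range.FiniteIndex := by
    rw [MonoidHom.range_comp, inclusion_range]
    exact finiteIndex_iff.2 (ne_zero_of_dvd_ne_zero FiniteIndex.index_ne_zero
        ((H.subgroupOf K).index_map_dvd (QuotientGroup.mk'_surjective _)))
  exact torsionFreeRank_factor_eq φ i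

end LinearAction

/-! ### Growth of subgroups of finite index and of quotients. -/

section Schreier

variable {G : Type*} [Group G] {X : Set G}

theorem mem_wordBall_succ_of_cons {x y : G} {n : ℕ} (hx : x ∈ X ∨ x⁻¹ ∈ X) (hy : y ∈ wordBall X n) :
    x * y ∈ wordBall X (n + 1) := by
  have h : x ∈ wordBall X 1 := ⟨[x], by simp, by simpa using hx, by simp⟩
  rw [add_comm]
  exact mul_mem_wordBall h hy

theorem wordBall_induction {p : ℕ → G → Prop} (one : ∀ n, p n 1)
    (cons : ∀ x y n, (x ∈ X ∨ x⁻¹ ∈ X) → p n y → p (n + 1) (x * y)) {n : ℕ} {g : G}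
    (hg : g ∈ wordBall X n) : p n g := by
  obtain ⟨l, hl, hl', rfl⟩ := hg
  induction l generalizing n with
  | nil => exact one n
  | cons x l ih =>
    obtain ⟨n, rfl⟩ : ∃ k, n = k + 1 := ⟨n - 1, by simp at hl; omega⟩
    rw [List.prod_cons]
    exact cons x _ n (hl' x (by simp)) (ih (by simpa using hl) fun y hy => hl' y (by simp [hy]))

theorem exists_mem_wordBall (hX : closure X = ⊤) (g : G) : ∃ n, g ∈ wordBall X n := by
  have hg : g ∈ (closure X).toSubmonoid := by rw [hX]; exact mem_top g
  rw [closure_toSubmonoid] at hg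
  obtain ⟨l, hl, h⟩ := Submonoid.exists_list_of_mem_closure hg
  exact ⟨l.length, l, le_rfl, hl, h⟩

variable (K : Subgroup G)

/-- If two consecutive balls meet the same cosets, that set of cosets is stable under left
multiplication by generators and so is everything; until then each step gains a coset. -/
theorem coset_wordBall_eq_univ_or [K.FiniteIndex] (hX : closure X = ⊤) (j : ℕ) :
    (QuotientGroup.mk : G → G ⧸ K) '' wordBall X j = Set.univ ∨
      j + 1 ≤ ((QuotientGroup.mk : G → G ⧸ K) '' wordBall X j).ncard := by
  have := finite_quotient_of_finiteIndex (H := K)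
  induction j with
  | zero =>
    right
    rw [zero_add, Nat.succ_le_iff, Set.ncard_pos]
    exact ⟨_, 1, one_mem_wordBall 0, rfl⟩
  | succ j ih =>
    have hsub := Set.image_mono (f := (QuotientGroup.mk : G → G ⧸ K))
      (wordBall_mono (X := X) j.le_succ)
    rcases ih with h | h
    · left; exact Set.eq_univ_of_univ_subset (h ▸ hsub)
    by_cases he : (QuotientGroup.mk : G → G ⧸ K) '' wordBall X (j + 1) ⊆
        QuotientGroup.mk '' wordBall X j
    · left
      refine Set.eq_univ_of_forall fun q => ?_
      obtain ⟨g, rfl⟩ := QuotientGroup.mk_surjective q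
      refine hsub ?_
      obtain ⟨n, hg⟩ := exists_mem_wordBall hX g
      refine wordBall_induction (p := fun _ (g : G) => (g : G ⧸ K) ∈ QuotientGroup.mk '' wordBall X j)
        (fun _ => ⟨1, one_mem_wordBall j, rfl⟩) ?_ hg
      rintro x y _ hx ⟨z, hz, hzy⟩
      refine he ⟨x * z, mem_wordBall_succ_of_cons hx hz, ?_⟩
      rw [QuotientGroup.eq] at hzy ⊢
      convert hzy using 1
      group
    · right
      exact Nat.succ_le_of_lt (h.trans_lt (Set.ncard_lt_ncard ⟨hsub, he⟩))

theorem exists_coset_rep_mem_wordBall [K.FiniteIndex] (hX : closure X = ⊤) (g : G) :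
    ∃ r ∈ wordBall X (K.index - 1), r⁻¹ * g ∈ K := by
  have := finite_quotient_of_finiteIndex (H := K)
  have hpos : 0 < K.index := Nat.pos_of_ne_zero FiniteIndex.index_ne_zero
  have h : (QuotientGroup.mk : G → G ⧸ K) '' wordBall X (K.index - 1) = Set.univ := by
    refine (coset_wordBall_eq_univ_or K hX (K.index - 1)).elim id fun h => ?_
    rw [Nat.sub_add_cancel hpos] at h
    refine Set.eq_of_subset_of_ncard_le (Set.subset_univ _) ?_
    rwa [Set.ncard_univ]
  obtain ⟨r, hr, e⟩ := h.symm ▸ Set.mem_univ (g : G ⧸ K)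
  exact ⟨r, hr, QuotientGroup.eq.1 e⟩

/-- The elements of a subgroup that are short enough to contain a set of Schreier generators. -/
def schreierBall (X : Set G) : Set K := {y | (y : G) ∈ wordBall X (2 * K.index - 1)}

theorem schreierBall_finite (hX : X.Finite) : (schreierBall K X).Finite :=
  (wordBall_finite hX _).preimage Subtype.val_injective.injOn

/-- Schreier rewriting: `x * r = s * (s⁻¹ * x * r)`, where `s` represents the coset of `x * r`. The
element left in `K` has length at most `(K.index - 1) + 1 + (K.index - 1)`. -/
theorem exists_mul_eq_of_mem_wordBall [K.FiniteIndex] (hX : closure X = ⊤) {n : ℕ} {g : G}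
    (hg : g ∈ wordBall X n) :
    ∃ r ∈ wordBall X (K.index - 1), ∃ u ∈ wordBall (schreierBall K X) n, r * (u : G) = g := by
  refine wordBall_induction (p := fun n g => ∃ r ∈ wordBall X (K.index - 1),
    ∃ u ∈ wordBall (schreierBall K X) n, r * (u : G) = g)
    (fun n => ⟨1, one_mem_wordBall _, 1, one_mem_wordBall n, by simp⟩) ?_ hg
  rintro x _ n hx ⟨r, hr, u, hu, rfl⟩
  obtain ⟨s, hs, h⟩ := exists_coset_rep_mem_wordBall K hX (x * r)
  refine ⟨s, hs, ⟨s⁻¹ * (x * r), h⟩ * u, mem_wordBall_succ_of_cons (Or.inl ?_) hu, ?_⟩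
  · refine wordBall_mono ?_ (mul_mem_wordBall (inv_mem_wordBall hs) (mem_wordBall_succ_of_cons hx hr))
    have hpos : 0 < K.index := Nat.pos_of_ne_zero FiniteIndex.index_ne_zero
    omega
  · rw [coe_mul]; group

theorem coe_mem_wordBall_of_mem_wordBall_schreierBall {n : ℕ} {u : K}
    (hu : u ∈ wordBall (schreierBall K X) n) : (u : G) ∈ wordBall X ((2 * K.index - 1) * n) := by
  refine wordBall_induction (p := fun n (u : K) => (u : G) ∈ wordBall X ((2 * K.index - 1) * n))
    (fun n => one_mem_wordBall _) ?_ hu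
  intro x y n hx hy
  rw [mul_add, mul_one, add_comm, coe_mul]
  refine mul_mem_wordBall (hx.elim id fun h => ?_) hy
  have := inv_mem_wordBall (h : ((x⁻¹ : K) : G) ∈ _)
  simpa using this

theorem mem_closure_of_mem_wordBall {n : ℕ} {g : G} (hg : g ∈ wordBall X n) : g ∈ closure X := by
  refine wordBall_induction (p := fun _ g => g ∈ closure X) (fun _ => one_mem _) ?_ hg
  intro x y _ hx hy
  exact mul_mem (hx.elim (fun h => subset_closure h)
    fun h => inv_mem_iff.1 (subset_closure h)) hy

theorem closure_schreierBall [K.FiniteIndex] (hX : closure X = ⊤) :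
    closure (schreierBall K X) = ⊤ := by
  rw [eq_top_iff]
  intro g _
  obtain ⟨n, hg⟩ := exists_mem_wordBall hX (g : G)
  obtain ⟨r, hr, u, hu, e⟩ := exists_mul_eq_of_mem_wordBall K hX hg
  have hrK : r ∈ K := by
    have : r = g * (u : G)⁻¹ := by rw [← e]; group
    rw [this]; exact mul_mem g.2 (inv_mem u.2)
  have : (⟨r, hrK⟩ : K) * u = g := Subtype.ext e
  rw [← this]
  refine mul_mem (subset_closure (wordBall_mono (by omega) hr)) (mem_closure_of_mem_wordBall hu)

theorem wordGrowth_le_mul_wordGrowth_schreierBall [K.FiniteIndex] (hX : closure X = ⊤)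
    (hfin : X.Finite) (n : ℕ) :
    wordGrowth X n ≤ (wordBall X (K.index - 1)).ncard * wordGrowth (schreierBall K X) n := by
  have h₁ := wordBall_finite hfin (K.index - 1)
  have h₂ := wordBall_finite (schreierBall_finite K hfin) n
  rw [wordGrowth, wordGrowth, ← Set.ncard_prod]
  refine (Set.ncard_le_ncard ?_ ((h₁.prod h₂).image fun p : G × K => p.1 * (p.2 : G))).trans
    (Set.ncard_image_le (h₁.prod h₂))
  intro g hg
  obtain ⟨r, hr, u, hu, e⟩ := exists_mul_eq_of_mem_wordBall K hX hg
  exact ⟨(r, u), ⟨hr, hu⟩, e⟩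

theorem wordGrowth_schreierBall_le (hfin : X.Finite) (n : ℕ) :
    wordGrowth (schreierBall K X) n ≤ wordGrowth X ((2 * K.index - 1) * n) :=
  Set.ncard_le_ncard_of_injOn Subtype.val
    (fun _ hu => coe_mem_wordBall_of_mem_wordBall_schreierBall K hu)
    Subtype.val_injective.injOn (wordBall_finite hfin _)

theorem wordGrowth_image_le {Q : Type*} [Group Q] (f : G →* Q) (hfin : X.Finite) (n : ℕ) :
    wordGrowth (f '' X) n ≤ wordGrowth X n := by
  refine (Set.ncard_le_ncard ?_ ((wordBall_finite hfin n).image f)).trans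
    (Set.ncard_image_le (wordBall_finite hfin n))
  intro q hq
  refine wordBall_induction (p := fun n q => q ∈ f '' wordBall X n)
    (fun n => ⟨1, one_mem_wordBall n, map_one f⟩) ?_ hq
  rintro x _ n hx ⟨y, hy, rfl⟩
  rcases hx with ⟨z, hz, rfl⟩ | ⟨z, hz, hzx⟩
  · exact ⟨z * y, mem_wordBall_succ_of_cons (Or.inl hz) hy, map_mul f z y⟩
  · refine ⟨z⁻¹ * y, mem_wordBall_succ_of_cons (Or.inr (by simpa using hz)) hy, ?_⟩
    rw [map_mul, map_inv, hzx, inv_inv]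

end Schreier

/-! ### Minkowski's bound on finite subgroups of `GL_k(ℤ)`. -/

section Minkowski

theorem exists_one_add_pow_eq {R : Type*} [Ring R] (N : R) (n : ℕ) :
    ∃ Q, (1 + N) ^ n = 1 + (n : ℤ) • N + N ^ 2 * Q := by
  induction n with
  | zero => exact ⟨0, by simp⟩
  | succ n ih =>
    obtain ⟨Q, h⟩ := ih
    refine ⟨(n : ℤ) • 1 + Q * (1 + N), ?_⟩
    rw [pow_succ, h]
    simp only [Nat.cast_succ, add_smul, one_smul, mul_add, add_mul, one_mul, mul_one, smul_mul_assoc,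
      mul_smul_comm, mul_assoc, pow_two]
    abel

variable {k : ℕ}

theorem exists_eq_smul_of_dvd {m : ℤ} {B : Matrix (Fin k) (Fin k) ℤ} (h : ∀ i j, m ∣ B i j) :
    ∃ B', B = m • B' := by
  choose B' hB' using h
  exact ⟨B', by ext i j; exact hB' i j⟩

/-- Infinite descent: the entries of `N` are divisible by every power of `3`. -/
theorem matrix_eq_zero_of_forall_pow_smul {N : Matrix (Fin k) (Fin k) ℤ}
    (h₁ : ∃ B, N = (3 : ℤ) • B)
    (h : ∀ (a : ℕ) (B : Matrix (Fin k) (Fin k) ℤ), N = (3 : ℤ) ^ (a + 1) • B → ∃ B', B = (3 : ℤ) • B') :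
    N = 0 := by
  have key : ∀ a : ℕ, ∃ B, N = (3 : ℤ) ^ (a + 1) • B := fun a => by
    induction a with
    | zero => simpa using h₁
    | succ a ih =>
      obtain ⟨B, hB⟩ := ih
      obtain ⟨B', hB'⟩ := h a B hB
      exact ⟨B', by rw [hB, hB', smul_smul, ← pow_succ]⟩
  ext i j
  obtain ⟨B, hB⟩ := key (N i j).natAbs
  have hd : (3 : ℤ) ^ ((N i j).natAbs + 1) ∣ N i j := ⟨B i j, congrFun (congrFun hB i) j⟩
  refine Int.eq_zero_of_dvd_of_natAbs_lt_natAbs hd ?_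
  rw [Int.natAbs_pow]
  exact (Nat.lt_succ_self _).trans (Nat.lt_pow_self (by norm_num))

/-- If `3 ∤ n`, then `n N = -N² Q` makes the quotient of `N` by any power `3 ^ (a + 1)` again
divisible by `3`. For `n = 3` the same descent applies to `3N + 3N² + N³ = 0`. For other multiples
of `3`, `(1 + N) ^ 3` is again `1` modulo `3`, and the exponents `n / 3` and then `3` are both
smaller. -/
theorem matrix_eq_zero_of_one_add_pow_eq_one {n : ℕ} (hn : 0 < n) {N : Matrix (Fin k) (Fin k) ℤ}
    (hN : ∃ B, N = (3 : ℤ) • B) (h : (1 + N) ^ n = 1) : N = 0 := by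
  have cancel : ∀ (a : ℕ) (B : Matrix (Fin k) (Fin k) ℤ), (3 : ℤ) ^ a • B = 0 → B = 0 :=
    fun a B hB => (smul_eq_zero.1 hB).resolve_left (by positivity)
  induction n using Nat.strong_induction_on generalizing N with
  | _ n ih =>
  by_cases h3 : 3 ∣ n
  · obtain ⟨m, rfl⟩ := h3
    have hm : 0 < m := by omega
    by_cases hm1 : m = 1
    · refine matrix_eq_zero_of_forall_pow_smul hN fun a B hB => ?_
      have e : (1 + N) ^ 3 = 1 + ((3 : ℤ) • N + (3 : ℤ) • (N * N) + N * N * N) := by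
        simp only [pow_succ, pow_zero, mul_add, add_mul, one_mul, mul_one, mul_assoc]
        have : ∀ x : Matrix (Fin k) (Fin k) ℤ, (3 : ℤ) • x = x + x + x := fun x => by
          rw [show (3 : ℤ) = 1 + 1 + 1 by norm_num, add_smul, add_smul, one_smul]
        rw [this, this]
        abel
      rw [hm1, mul_one, e, add_eq_left, hB] at h
      have h' : (3 : ℤ) ^ (a + 2) • (B + (3 : ℤ) • ((3 : ℤ) ^ a • (B * B) +
          (3 : ℤ) ^ (2 * a) • (B * B * B))) = 0 := by
        rw [← h]
        simp only [smul_mul_assoc, mul_smul_comm]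
        module
      exact ⟨_, (eq_neg_of_add_eq_zero_left (cancel _ _ h')).trans (smul_neg _ _).symm⟩
    · obtain ⟨Q, hQ⟩ := exists_one_add_pow_eq N 3
      have h₁ : ∃ B, (1 + N) ^ 3 = 1 + (3 : ℤ) • B := by
        obtain ⟨B, hB⟩ := hN
        refine ⟨N + B * (N * Q), ?_⟩
        rw [hQ, smul_add, add_assoc, pow_two, ← smul_mul_assoc, ← hB, mul_assoc]
        rfl
      obtain ⟨B, hB⟩ := h₁
      have h₂ : (3 : ℤ) • B = 0 := ih m (by omega) hm ⟨B, rfl⟩ (by rw [← hB, ← pow_mul, h])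
      rw [h₂, add_zero] at hB
      exact ih 3 (by omega) (by norm_num) hN hB
  · refine matrix_eq_zero_of_forall_pow_smul hN fun a B hB => ?_
    obtain ⟨Q, hQ⟩ := exists_one_add_pow_eq N n
    rw [h, add_assoc, eq_comm, add_eq_left, hB] at hQ
    have h' : (3 : ℤ) ^ (a + 1) • ((n : ℤ) • B + (3 : ℤ) • ((3 : ℤ) ^ a • (B * B * Q))) = 0 := by
      rw [← hQ]
      simp only [smul_mul_assoc, mul_smul_comm, smul_add, smul_smul, pow_two]
      congr 2 <;> ring
    have h'' := cancel _ _ h'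
    refine exists_eq_smul_of_dvd fun i j => ?_
    have hij := congrFun (congrFun h'' i) j
    simp only [Matrix.add_apply, Matrix.smul_apply, Matrix.zero_apply, smul_eq_mul] at hij
    have hd : (3 : ℤ) ∣ n * B i j := ⟨-_, (eq_neg_of_add_eq_zero_left hij).trans (mul_neg _ _).symm⟩
    exact ((Int.prime_three).dvd_mul.1 hd).resolve_left (by exact_mod_cast h3)

theorem card_le_of_finite_subgroup_GL (F : Subgroup (Matrix.GeneralLinearGroup (Fin k) ℤ)) [Finite F] :
    Nat.card F ≤ Nat.card (Matrix.GeneralLinearGroup (Fin k) (ZMod 3)) := by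
  let ψ : F →* Matrix.GeneralLinearGroup (Fin k) (ZMod 3) :=
    (Matrix.GeneralLinearGroup.map (Int.castRingHom (ZMod 3))).comp F.subtype
  refine Nat.card_le_card_of_injective ψ ((injective_iff_map_eq_one ψ).2 fun x hx => ?_)
  let A : Matrix (Fin k) (Fin k) ℤ := (x : Matrix.GeneralLinearGroup (Fin k) ℤ)
  have hA : A - 1 = 0 := by
    refine matrix_eq_zero_of_one_add_pow_eq_one (orderOf_pos x) (exists_eq_smul_of_dvd fun i j => ?_) ?_
    · have h := congrArg (fun y : Matrix.GeneralLinearGroup (Fin k) (ZMod 3) =>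
        (y : Matrix (Fin k) (Fin k) (ZMod 3)) i j) hx
      replace h : ((A i j : ℤ) : ZMod 3) = (1 : Matrix (Fin k) (Fin k) (ZMod 3)) i j := h
      refine (ZMod.intCast_zmod_eq_zero_iff_dvd _ 3).1 ?_
      rw [Matrix.sub_apply, Int.cast_sub, h, Matrix.one_apply, Matrix.one_apply]
      split <;> simp
    · have h := congrArg (fun y : F => ((y : Matrix.GeneralLinearGroup (Fin k) ℤ) :
        Matrix (Fin k) (Fin k) ℤ)) (pow_orderOf_eq_one x)
      rw [add_sub_cancel]
      exact h
  exact Subtype.ext (Units.ext (sub_eq_zero.1 hA))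

theorem isGreatest_maxFiniteOrderGL (k : ℕ) :
    IsGreatest (finiteSubgroupOrdersGL k) (maxFiniteOrderGL k) := by
  have hb : BddAbove (finiteSubgroupOrdersGL k) := ⟨_, by
    rintro _ ⟨F, hF, rfl⟩; exact card_le_of_finite_subgroup_GL F⟩
  exact ⟨Nat.sSup_mem ⟨_, ⊥, inferInstance, rfl⟩ hb, fun _ hm => le_csSup hb hm⟩

theorem maxFiniteOrderGL_pos (k : ℕ) : 0 < maxFiniteOrderGL k := by
  obtain ⟨F, hF, h⟩ := (isGreatest_maxFiniteOrderGL k).1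
  rw [← h]; exact Nat.card_pos

theorem exists_injective_GL_add (k j : ℕ) : ∃ f : Matrix.GeneralLinearGroup (Fin k) ℤ →*
    Matrix.GeneralLinearGroup (Fin (k + j)) ℤ, Function.Injective f := by
  let e : Matrix (Fin k) (Fin k) ℤ →* Matrix (Fin (k + j)) (Fin (k + j)) ℤ :=
    { toFun := fun A => Matrix.reindexAlgEquiv ℤ ℤ finSumFinEquiv (Matrix.fromBlocks A 0 0 1)
      map_one' := by rw [Matrix.fromBlocks_one, map_one]
      map_mul' := fun A B => by
        rw [← map_mul, Matrix.fromBlocks_multiply]; simp }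
  refine ⟨Units.map e, Units.map_injective fun A B h => ?_⟩
  exact (Matrix.fromBlocks_inj.1 ((Matrix.reindexAlgEquiv ℤ ℤ finSumFinEquiv).injective h)).1

theorem maxFiniteOrderGL_mono : Monotone maxFiniteOrderGL := by
  intro k l hkl
  obtain ⟨j, rfl⟩ := Nat.exists_eq_add_of_le hkl
  obtain ⟨f, hf⟩ := exists_injective_GL_add k j
  obtain ⟨F, hF, h⟩ := (isGreatest_maxFiniteOrderGL k).1
  refine (isGreatest_maxFiniteOrderGL (k + j)).2 ⟨F.map f, ?_, ?_⟩
  · exact Finite.of_equiv F (F.equivMapOfInjective f hf).toEquiv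
  · rw [← h]; exact (Nat.card_congr (F.equivMapOfInjective f hf).toEquiv).symm

end Minkowski

/-! ### Assembling the growth estimates. -/

section Growth

variable {G : Type*} [Group G]

theorem exists_wordGrowth_le_of_finiteIndex {H : Subgroup G} [H.FiniteIndex] [Group.IsNilpotent H]
    {S : Set G} (hS : closure S = ⊤) (hfin : S.Finite) {c : ℕ} (hc : lcs H c = ⊥) :
    ∃ C : ℕ, ∀ n : ℕ, 1 ≤ n → wordGrowth S n ≤
      C * n ^ (∑ i ∈ Finset.range c, (i + 1) * torsionFreeRank (LowerCentralFactor H i)) := by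
  obtain ⟨C, hC⟩ := exists_wordGrowth_le (closure_schreierBall H hS) (schreierBall_finite H hfin) hc
  refine ⟨(wordBall S (H.index - 1)).ncard * C, fun n hn => ?_⟩
  rw [mul_assoc]
  exact (wordGrowth_le_mul_wordGrowth_schreierBall H hS hfin n).trans
    (Nat.mul_le_mul_left _ (hC n hn))

/-- The nilpotent bound in `K ⧸ lcs K k` is pulled back to `K` along the quotient map, then to `G`,
where the Schreier generators cost a factor `2 * m - 1`. The number `m` is independent of `S`. -/
theorem exists_pow_le_wordGrowth [Group.FG G] {H : Subgroup G} [H.Normal] [H.FiniteIndex]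
    [Group.IsNilpotent H] {c D : ℕ}
    (hD : D = ∑ i ∈ Finset.range c, (i + 1) * torsionFreeRank (LowerCentralFactor H i)) :
    ∃ m ∈ finiteSubgroupOrdersGL (torsionFreeRank (LowerCentralFactor H 0)), 0 < m ∧
      ∀ S : Set G, S.Finite → closure S = ⊤ →
        ∀ j, j ^ D ≤ wordGrowth S ((2 * m - 1) * (2 ^ D * j)) := by
  obtain ⟨K, hHK, hK, k, hk⟩ := exists_subgroup_finite_lcs H
  have : K.FiniteIndex := finiteIndex_of_le hHK
  refine ⟨K.index, hK, Nat.pos_of_ne_zero FiniteIndex.index_ne_zero, fun S hfin hS j => ?_⟩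
  have : Group.FG K := fg_of_index_ne_zero K
  have hfin' := schreierBall_finite K hfin
  have hgen : closure (QuotientGroup.mk' (lcs K k) '' schreierBall K S) = ⊤ := by
    rw [← MonoidHom.map_closure, closure_schreierBall K hS, ← MonoidHom.range_eq_map,
      MonoidHom.range_eq_top.2 (QuotientGroup.mk'_surjective _)]
  refine (pow_le_wordGrowth_two_pow_mul hgen (hfin'.image _) j c D ?_).trans
    ((wordGrowth_image_le _ hfin' _).trans (wordGrowth_schreierBall_le K hfin _))
  rw [hD]
  exact Finset.sum_congr rfl fun i _ => by rw [torsionFreeRank_factor_quotient_lcs_eq hHK hk i]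

/-- If `a < D`, dividing by `k ^ a` would bound `k ^ (D - a)`, which tends to infinity. -/
theorem le_of_pow_le_mul_rpow {D L : ℕ} {a C : ℝ}
    (h : ∀ k : ℕ, 1 ≤ k → (k : ℝ) ^ D ≤ C * ((L * k : ℕ) : ℝ) ^ a) : (D : ℝ) ≤ a := by
  by_contra! hlt
  have h₁ : Filter.Tendsto (fun k : ℕ => (k : ℝ) ^ ((D : ℝ) - a)) Filter.atTop Filter.atTop :=
    (tendsto_rpow_atTop (sub_pos.2 hlt)).comp tendsto_natCast_atTop_atTop
  obtain ⟨k, hk, hk1⟩ := ((h₁.eventually_gt_atTop (C * (L : ℝ) ^ a)).and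
    (Filter.eventually_ge_atTop 1)).exists
  have hk0 : (0 : ℝ) < k := by exact_mod_cast hk1
  have h₂ := h k hk1
  rw [Nat.cast_mul, Real.mul_rpow (Nat.cast_nonneg _) hk0.le, ← mul_assoc] at h₂
  have h₃ : (k : ℝ) ^ D = (k : ℝ) ^ ((D : ℝ) - a) * (k : ℝ) ^ a := by
    rw [← Real.rpow_add hk0, sub_add_cancel, Real.rpow_natCast]
  rw [h₃] at h₂
  exact absurd (le_of_mul_le_mul_right h₂ (Real.rpow_pos_of_pos hk0 a)) (not_le.2 hk)

theorem eq_of_hasGrowthDegree {d D : ℕ} (hdeg : HasGrowthDegree G (d : ℝ))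
    (hupper : ∀ S : Set G, S.Finite → closure S = ⊤ →
      ∃ C : ℕ, ∀ n : ℕ, 1 ≤ n → wordGrowth S n ≤ C * n ^ D)
    {L : ℕ} (hL : 0 < L) (hlower : ∀ S : Set G, S.Finite → closure S = ⊤ →
      ∀ j, j ^ D ≤ wordGrowth S (L * j)) : d = D := by
  obtain ⟨S, hfin, hS, -, hglb⟩ := hdeg
  refine le_antisymm ?_ ?_
  · obtain ⟨C, hC⟩ := hupper S hfin hS
    refine Nat.cast_le.1 (hglb.1 (⟨C, fun n hn => ?_⟩ : (D : ℝ) ∈ growthExponents S))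
    rw [Real.rpow_natCast]
    exact_mod_cast hC n hn
  · refine Nat.cast_le.1 (hglb.2 (fun a ⟨C, hC⟩ => ?_ : (D : ℝ) ∈ lowerBounds (growthExponents S)))
    refine le_of_pow_le_mul_rpow (L := L) (C := C) fun k hk => ?_
    refine le_trans ?_ (hC (L * k) (Nat.mul_pos hL hk))
    exact_mod_cast hlower S hfin hS k

/-- With `t = max 1 (n / L)`, the ball of radius `n` has at least `t ^ d` elements, while `n ≤ 2 * L
* t ≤ 2 ^ (d + 2) * g * t`. The value `t = 1` covers radii below `L`. -/
theorem pow_div_le_wordGrowth {X : Set G} (hfin : X.Finite) {d m g : ℕ} (hm : 0 < m) (hmg : m ≤ g)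
    (h : ∀ j, j ^ d ≤ wordGrowth X ((2 * m - 1) * (2 ^ d * j))) (n : ℕ) :
    (n : ℝ) ^ d / (2 ^ (d * (d + 2)) * (g : ℝ) ^ d) ≤ wordGrowth X n := by
  set L := (2 * m - 1) * 2 ^ d with hL
  have hLpos : 0 < L := Nat.mul_pos (by omega) (by positivity)
  have hLle : 2 * L ≤ 2 ^ (d + 2) * g := by
    calc 2 * L ≤ 2 * (2 * g * 2 ^ d) := by
          rw [hL]; exact Nat.mul_le_mul_left _ (Nat.mul_le_mul_right _ (by omega))
      _ = 2 ^ (d + 2) * g := by ring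
  obtain ⟨t, ht, hnt⟩ : ∃ t : ℕ, t ^ d ≤ wordGrowth X n ∧ n ≤ 2 ^ (d + 2) * g * t := by
    have hn : n < L * (n / L + 1) := Nat.lt_mul_div_succ n hLpos
    rcases Nat.eq_zero_or_pos (n / L) with h0 | hpos
    · refine ⟨1, ?_, ?_⟩
      · rw [one_pow]
        exact (Set.ncard_pos (wordBall_finite hfin n)).2 ⟨1, one_mem_wordBall n⟩
      · rw [h0] at hn; omega
    · refine ⟨n / L, (h _).trans ?_, ?_⟩
      · rw [← mul_assoc, ← hL]
        exact Set.ncard_le_ncard (wordBall_mono (Nat.mul_div_le n L)) (wordBall_finite hfin n)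
      · calc n ≤ L * (n / L + 1) := hn.le
          _ ≤ L * (2 * (n / L)) := Nat.mul_le_mul_left _ (by omega)
          _ = 2 * L * (n / L) := by ring
          _ ≤ _ := Nat.mul_le_mul_right _ hLle
  have hg : (0 : ℝ) < g := by exact_mod_cast hm.trans_le hmg
  refine le_trans ?_ (Nat.cast_le.2 ht)
  rw [div_le_iff₀ (by positivity), Nat.cast_pow]
  calc (n : ℝ) ^ d ≤ (2 ^ (d + 2) * g * t) ^ d := by
        gcongr; exact_mod_cast hnt
    _ = _ := by rw [mul_pow, mul_pow, ← pow_mul, mul_comm (d + 2) d]; ring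

theorem exists_normal_nilpotent_finiteIndex (hG : Group.IsVirtuallyNilpotent G) :
    ∃ H : Subgroup G, H.Normal ∧ H.FiniteIndex ∧ Group.IsNilpotent H := by
  obtain ⟨N, hN, hfi⟩ := hG
  exact ⟨N.normalCore, inferInstance, inferInstance,
    Group.nilpotent_of_mulEquiv (subgroupOfEquivOfLe N.normalCore_le)⟩

end Growth

/-- The first two conjuncts say that the quantities `h(G)` and `g(k)` are what they are meant to be:
`h(G)` is the Hirsch length of every nilpotent subgroup of finite index, and `g(k)` is a maximum.
The third is the growth bound. -/
theorem mainTheorem1 {G : Type*} [Group G] (hG : Group.IsVirtuallyNilpotent G)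
    (d : ℕ) (hd : 1 ≤ d) (hdeg : HasGrowthDegree G (d : ℝ))
    (X : Set G) (hXfin : X.Finite) (hXgen : Subgroup.closure X = ⊤) :
    (∀ (H : Subgroup G) [Group.IsNilpotent H], H.FiniteIndex →
      nilpotentHirschLength H = hirschLength G) ∧
    (∀ k : ℕ, IsGreatest (finiteSubgroupOrdersGL k) (maxFiniteOrderGL k)) ∧
    ∀ n : ℕ, 1 ≤ n →
      (wordGrowth X n : ℝ) ≥
          (n : ℝ) ^ d / (2 ^ (d * (d + 2)) * (maxFiniteOrderGL (hirschLength G) : ℝ) ^ d) ∧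
        (n : ℝ) ^ d / (2 ^ (d * (d + 2)) * (maxFiniteOrderGL (hirschLength G) : ℝ) ^ d) ≥
          (n : ℝ) ^ d / (2 ^ (d * (d + 2)) * (maxFiniteOrderGL d : ℝ) ^ d) := by
  have : Group.FG G := Group.fg_iff.2 ⟨X, hXgen, hXfin⟩
  refine ⟨fun H _ _ => hirschLength_eq H, isGreatest_maxFiniteOrderGL, fun n _ => ?_⟩
  obtain ⟨H, _, _, _⟩ := exists_normal_nilpotent_finiteIndex hG
  -- One more than the class, so that index `0` occurs in the sums even when `H` is trivial; this is
  -- used to compare the rank of the first factor with the Hirsch length.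
  set c := Group.nilpotencyClass H + 1
  have hc : lcs H c = ⊥ :=
    Subgroup.lowerCentralSeries_eq_bot_iff_nilpotencyClass_le.2 (Nat.le_succ _)
  obtain ⟨D, hD⟩ : ∃ D, D = ∑ i ∈ Finset.range c,
    (i + 1) * torsionFreeRank (LowerCentralFactor H i) := ⟨_, rfl⟩
  have hh : hirschLength G = ∑ i ∈ Finset.range c, torsionFreeRank (LowerCentralFactor H i) := by
    rw [← hirschLength_eq H, nilpotentHirschLength_eq_sum (Nat.le_succ _)]
  obtain ⟨m, hm, hmpos, hlower⟩ := exists_pow_le_wordGrowth hD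
  -- The upper and lower bounds have the same exponent `D`, which must therefore be the growth
  -- degree.
  obtain rfl : d = D := by
    refine eq_of_hasGrowthDegree hdeg (fun S hfin hS => ?_)
      (L := (2 * m - 1) * 2 ^ D) (Nat.mul_pos (by omega) (by positivity)) fun S hfin hS j => ?_
    · rw [hD]; exact exists_wordGrowth_le_of_finiteIndex hS hfin hc
    · rw [mul_assoc]; exact hlower S hfin hS j
  have hhd : hirschLength G ≤ d := by
    rw [hh, hD]
    exact Finset.sum_le_sum fun i _ => Nat.le_mul_of_pos_left _ i.succ_pos
  have hrank : torsionFreeRank (LowerCentralFactor H 0) ≤ hirschLength G := by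
    rw [hh]
    exact Finset.single_le_sum (f := fun i => torsionFreeRank (LowerCentralFactor H i))
      (fun i _ => Nat.zero_le _) (Finset.mem_range.2 (Nat.succ_pos _))
  refine ⟨pow_div_le_wordGrowth hXfin hmpos (((isGreatest_maxFiniteOrderGL _).2 hm).trans
    (maxFiniteOrderGL_mono hrank)) (hlower X hXfin hXgen) n, ?_⟩
  have hpos : (0 : ℝ) < maxFiniteOrderGL (hirschLength G) := by
    exact_mod_cast maxFiniteOrderGL_pos _
  have hle : (maxFiniteOrderGL (hirschLength G) : ℝ) ≤ maxFiniteOrderGL d := by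
    exact_mod_cast maxFiniteOrderGL_mono hhd
  rw [ge_iff_le]
  gcongr
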